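/- All graphs are finite, simple and undirected. Let $k,h,\ell,w$ be positive integers, let $H$ be a graph with $h$ vertices, let $G$ be a graph of tree-width at most $w$, and let $\mathcal Z$ be a finite multiset of subsets of $V(G)$ (members are always counted with multiplicity). A *model function* of a graph $H'$ in $G$ is a map $\eta$ on $V(H')\cup E(H')$ such that the $\eta(v)$, $v\in V(H')$, are non-empty connected pairwise vertex-disjoint subgraphs of $G$, the $\eta(e)$, $e\in E(H')$, are distinct edges of $G$, and for each edge $e=uv$ of $H'$ the edge $\eta(e)$ has one end in $V(\eta(u))$ and the other in $V(\eta(v))$. Its *image* is the subgraph of $G$ formed by the union of all $\eta(v)$ together with all edges $\eta(e)$. An *$(H,\mathcal Z,\ell)$-model* is a subgraph $F$ of $G$ that is the image of a model function of $H$ in $G$ and such that at least $\ell$ members of $\mathcal Z$ contain a vertex of $F$. A *pure $(H,\mathcal Z,\ell)$-model* is a subgraph $F$ of $G$ for which there are distinct connected components $H_1,\dots,H_t$ of $H$, a model function $\eta$ of $H_1\cup\dots\cup H_t$ in $G$ with image $F$, and non-empty pairwise disjoint sub-multisets $\alpha(1),\dots,\alpha(t)$ of $\mathcal Z$ with $\ell$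 members in total, such that for every $i$ and every $Z\in\alpha(i)$ the set $\bigcup_{v\in V(H_i)}V(\eta(v))$ meets $Z$. A set $S\subseteq V(G)$ is a *(pure) $(H,\mathcal Z,\ell)$-deletion set* if $G-S$ contains no (pure) $(H,\mathcal Z,\ell)$-model. Then $G$ contains either $k$ pairwise vertex-disjoint $(H,\mathcal Z,\ell)$-models, or an $(H,\mathcal Z,\ell)$-deletion set of size at most $(w+1)(h^2-h+1)(k-1)$. Likewise, $G$ contains either $k$ pairwise vertex-disjoint pure $(H,\mathcal Z,\ell)$-models, or a pure $(H,\mathcal Z,\ell)$-deletion set of size at most $(w+1)(h^2-h+1)(k-1)$. -/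

import Mathlib

namespace RootedMinor

universe u v x

/-- A tree-decomposition of `G` over the tree `T`. -/
structure TreeDecomposition {V : Type u} (G : SimpleGraph V) {τ : Type x} (T : SimpleGraph τ) where
  isTree : T.IsTree
  bag : τ → Finset V
  cover : ∀ a : V, ∃ t, a ∈ bag t
  edge_mem : ∀ a b : V, G.Adj a b → ∃ t, a ∈ bag t ∧ b ∈ bag t
  path_mem : ∀ (t₁ t₂ t₃ : τ) (p : T.Walk t₁ t₃), p.IsPath → t₂ ∈ p.support →
    ∀ a : V, a ∈ bag t₁ → a ∈ bag t₃ → a ∈ bag t₂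

/-- The width `max |B_t| - 1`; it is an integer, so that the empty graph may have width `-1`. -/
def TreeDecomposition.width {V : Type u} {G : SimpleGraph V} {τ : Type x} [Fintype τ]
    {T : SimpleGraph τ} (D : TreeDecomposition G T) : ℤ :=
  ((Finset.univ.sup fun t => (D.bag t).card : ℕ) : ℤ) - 1

/-- The tree-width: the minimum width over all tree-decompositions over finite trees (up to
isomorphism, a finite tree has vertex set `Fin m`). For a finite graph the set below is nonempty
and bounded below by `-1`. -/
noncomputable def treeWidth {V : Type u} (G : SimpleGraph V) : ℤ :=
  sInf {n : ℤ | ∃ (m : ℕ) (T : SimpleGraph (Fin m)) (D : TreeDecomposition G T), D.width = n}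

/-- A minor-model function of `H` in `G`. -/
structure ModelFunction {V : Type u} {W : Type v} (H : SimpleGraph W) (G : SimpleGraph V) where
  branch : W → G.Subgraph
  edge : H.edgeSet → G.edgeSet
  /-- `SimpleGraph.Subgraph.Connected` includes being nonempty. -/
  branch_connected : ∀ a, (branch a).Connected
  branch_disjoint : ∀ a b, a ≠ b → Disjoint (branch a).verts (branch b).verts
  edge_injective : Function.Injective edge
  edge_ends : ∀ (a b : W) (hab : H.Adj a b),
    ∃ p ∈ (branch a).verts, ∃ q ∈ (branch b).verts,
      (edge ⟨s(a, b), hab⟩ : Sym2 V) = s(p, q)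

/-- The image of a minor-model function: the union of all `η(a)`, `a ∈ V(H)`, together with the
edges `η(e)`, `e ∈ E(H)`. -/
def ModelFunction.image {V : Type u} {W : Type v} {H : SimpleGraph W} {G : SimpleGraph V}
    (η : ModelFunction H G) : G.Subgraph where
  verts := ⋃ a, (η.branch a).verts
  Adj p q := (∃ a, (η.branch a).Adj p q) ∨ ∃ e, (η.edge e : Sym2 V) = s(p, q)
  adj_sub := by
    rintro p q (⟨a, h⟩ | ⟨e, h⟩)
    · exact h.adj_sub
    · have := (η.edge e).2
      rw [h] at this
      exact this
  edge_vert := by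
    rintro p q (⟨a, h⟩ | ⟨⟨e, he⟩, h⟩)
    · exact Set.mem_iUnion.2 ⟨a, h.fst_mem⟩
    · induction e using Sym2.ind with
      | _ a b =>
        obtain ⟨p', hp, q', hq, h'⟩ := η.edge_ends a b he
        rw [h] at h'
        rcases Sym2.eq_iff.1 h' with ⟨rfl, rfl⟩ | ⟨rfl, rfl⟩
        · exact Set.mem_iUnion.2 ⟨a, hp⟩
        · exact Set.mem_iUnion.2 ⟨b, hq⟩
  symm := ⟨by
    rintro p q (⟨a, h⟩ | ⟨e, h⟩)
    · exact Or.inl ⟨a, h.symm⟩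
    · exact Or.inr ⟨e, h.trans Sym2.eq_swap⟩⟩

/-- `F` is an `(H, 𝒵, ℓ)`-model in `G`. The multiset `𝒵` of vertex sets is given as a finite
family `Z : ι → Set V`, so that its members, with multiplicity, correspond to indices. -/
def IsRootedModel {V : Type u} {W : Type v} {ι : Type x} {G : SimpleGraph V}
    (H : SimpleGraph W) (Z : ι → Set V) (ℓ : ℕ) (F : G.Subgraph) : Prop :=
  (∃ η : ModelFunction H G, η.image = F) ∧ ℓ ≤ {i : ι | (F.verts ∩ Z i).Nonempty}.ncard

/-- The union of the connected components of `H` that belong to `C`. -/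
def componentUnion {W : Type v} (H : SimpleGraph W) (C : Set H.ConnectedComponent) :
    SimpleGraph {a : W // H.connectedComponentMk a ∈ C} :=
  H.comap Subtype.val

/-- `F` is a pure `(H, 𝒵, ℓ)`-model in `G`: it is the image of a model `η` of the union of a set
`C` of components of `H`, and there are nonempty pairwise disjoint subfamilies `α c` of `𝒵`, for
`c ∈ C`, with `ℓ` members altogether (empty sets not counted), such that the image of
the component `c` meets every member of `α c`. -/
def IsPureRootedModel {V : Type u} {W : Type v} {ι : Type x} {G : SimpleGraph V}
    (H : SimpleGraph W) (Z : ι → Set V) (ℓ : ℕ) (F : G.Subgraph) : Prop :=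
  ∃ (C : Set H.ConnectedComponent) (α : C → Set ι) (η : ModelFunction (componentUnion H C) G),
    η.image = F ∧
    (∀ c, (α c).Nonempty) ∧
    (∀ c, ∀ i ∈ α c, ∃ a, H.connectedComponentMk a.1 = c.1 ∧
      ((η.branch a).verts ∩ Z i).Nonempty) ∧
    (∀ c d, c ≠ d → Disjoint (α c) (α d)) ∧
    {i : ι | (∃ c, i ∈ α c) ∧ (Z i).Nonempty}.ncard = ℓ

/-- `G` contains `k` pairwise vertex-disjoint subgraphs with the property `P`. -/
def HasDisjoint {V : Type u} {G : SimpleGraph V} (P : G.Subgraph → Prop) (k : ℕ) : Prop :=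
  ∃ F : Fin k → G.Subgraph, (∀ i, P (F i)) ∧
    ∀ i j, i ≠ j → Disjoint (F i).verts (F j).verts

/-- `G - S` has no subgraph with the property `P`. -/
def IsDeletionSet {V : Type u} {G : SimpleGraph V} (P : G.Subgraph → Prop) (S : Finset V) : Prop :=
  ∀ F : G.Subgraph, F ≤ (⊤ : G.Subgraph).deleteVerts (S : Set V) → ¬ P F

end RootedMinor

/-! Only one property of (pure) models matters: their vertex set is a union of at least one and at
most `h` connected subgraphs, the branch sets. In a tree-decomposition of width at most `w`, the
nodes whose bags meet a connected subgraph form a subtree, so a model yields a subforest with at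
most `h` components. Models with disjoint subforests are vertex-disjoint, and if a set of nodes hits
all these subforests, the union of its bags is a deletion set. This reduces the claim to Berger's
theorem, `exists_pairwiseDisjoint_of_forall_exists_disjoint`: among subforests with at most `d`
components there are `j + 1` disjoint ones, unless `(d ^ 2 - d + 1) * j` nodes hit them all.

For Berger's theorem, put `n = (d ^ 2 - d + 1) * j` and suppose that no `n` nodes hit all members.
Weights on the members, summing to a constant slightly above `n / d`, place mass on the top nodes of
their components. The mass is collected from the leaves upwards, and the forest is cut wherever an
integer is passed. There are at most `n` cuts, so some member avoids them. A KKM theorem, deduced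
from Scarf's lemma, then provides weights for which every member of positive weight is uncut. Each
remaining piece has mass less than 1, so the weights form a fractional matching of the sets of
pieces occupied by the members. Its total exceeds `n / d = (d - 1 + 1 / d) * j`, and Füredi's
theorem gives `j + 1` members occupying disjoint sets of pieces. -/

namespace RootedMinor

open Finset

/-! ### Scarf's combinatorial lemma, by a parity argument on rooms and doors. -/

section Scarf

variable {I U L : Type*} [LinearOrder L]

/-- A set `A` is dominant for the utilities `v` if no element is strictly better than all of `A`
in the sense of exceeding the worst element of `A` for every `i`. -/
def Dominant (v : I → U → L) (A : Finset U) : Prop :=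
  ∀ y, ∃ i, ∀ x ∈ A, v i y ≤ v i x

/-- The element `s i` is the worst one for `i`, and for `k ≠ i` it is better than all elements
outside the range of `s`. -/
structure IsSlack (v : I → U → L) (s : I → U) : Prop where
  injective : Function.Injective s
  lt_of_ne : ∀ i u, u ≠ s i → v i (s i) < v i u
  lt_of_notMem : ∀ i k x, i ≠ k → x ∉ Set.range s → v k x < v k (s i)

theorem Dominant.mono {v : I → U → L} {A B : Finset U} (h : Dominant v A) (hBA : B ⊆ A) :
    Dominant v B := fun y => by
  obtain ⟨i, hi⟩ := h y
  exact ⟨i, fun x hx => hi x (hBA hx)⟩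

/-- The data of a dominant set `B` with `|B| + 1 = |I|`: the worst element `a i` of `B` for each
`i`, and the unique pair of indices sharing their worst element. -/
structure IsDoor (v : I → U → L) (B : Finset U) (a : I → U) (i j : I) : Prop where
  dominant : Dominant v B
  mem : ∀ k, a k ∈ B
  le : ∀ k, ∀ x ∈ B, v k (a k) ≤ v k x
  surj : ∀ b ∈ B, ∃ k, a k = b
  ne : i ≠ j
  eq : a i = a j
  pair : ∀ k l, k ≠ l → a k = a l → (k = i ∧ l = j) ∨ (k = j ∧ l = i)

theorem IsDoor.symm {v : I → U → L} {B : Finset U} {a : I → U} {i j : I}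
    (h : IsDoor v B a i j) : IsDoor v B a j i :=
  ⟨h.dominant, h.mem, h.le, h.surj, h.ne.symm, h.eq.symm, fun k l h1 h2 => (h.pair k l h1 h2).symm⟩

/-- Dominance tested on an element of `B` makes it the worst one for some index, so the
worst-element map is onto `B`. As `|B| = |I| - 1`, exactly one pair of indices shares its value. -/
theorem Dominant.exists_isDoor [Fintype I] [DecidableEq I] [DecidableEq U] {v : I → U → L}
    (hv : ∀ i, Function.Injective (v i)) {B : Finset U}
    (hB : Dominant v B) (hne : B.Nonempty) (hcard : B.card + 1 = Fintype.card I) :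
    ∃ a i j, IsDoor v B a i j := by
  choose a ha hmin using fun k => B.exists_min_image (v k) hne
  have hsurj : ∀ b ∈ B, ∃ k, a k = b := by
    intro b hb
    obtain ⟨k, hk⟩ := hB b
    exact ⟨k, hv k (le_antisymm (hmin k b hb) (hk _ (ha k)))⟩
  obtain ⟨i, -, j, -, hij, haij⟩ := Finset.exists_ne_map_eq_of_card_lt_of_maps_to
    (s := (univ : Finset I)) (t := B) (f := a) (by rw [card_univ]; omega) (by simp [Set.MapsTo, ha])
  have key : ∀ i j, i ≠ j → a i = a j → Set.InjOn a (univ.erase i : Finset I) := by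
    intro i j hij haij
    apply Finset.injOn_of_card_image_eq
    have : (univ.erase i).image a = B := by
      ext b
      constructor
      · simp only [mem_image]
        rintro ⟨k, -, rfl⟩
        exact ha k
      · intro hb
        obtain ⟨k, rfl⟩ := hsurj b hb
        by_cases hk : k = i
        · exact mem_image.2 ⟨j, by simp [hij.symm], by rw [hk, haij]⟩
        · exact mem_image.2 ⟨k, by simp [hk], rfl⟩
    rw [this, card_erase_of_mem (mem_univ _), card_univ]
    omega
  refine ⟨a, i, j, hB, ha, hmin, hsurj, hij, haij, ?_⟩
  intro k l hkl hakl
  have h1 := key i j hij haij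
  have h2 := key j i hij.symm haij.symm
  by_cases hki : k = i
  · subst hki
    by_cases hlj : l = j
    · exact Or.inl ⟨rfl, hlj⟩
    · exact absurd (h1 (by simp [hkl.symm]) (by simp [hij.symm]) (hakl.symm.trans haij)) hlj
  · by_cases hli : l = i
    · subst hli
      by_cases hkj : k = j
      · exact Or.inr ⟨hkj, rfl⟩
      · exact absurd (h1 (by simp [hkl]) (by simp [hij.symm]) (hakl.trans haij)) hkj
    · exact absurd (h1 (by simp [hki]) (by simp [hli]) hakl) hkl

/-- The elements exceeding the worst element of the door for every index other than `k`. -/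
def above (v : I → U → L) (a : I → U) (k : I) : Set U :=
  {y | ∀ l, l ≠ k → v l (a l) < v l y}

/-- When `y` becomes the worst element for `i`, the old one `a i = a j` remains worst for `j`, so no
index other than `i` changes its worst element. Dominance of the enlarged set then says that nothing
in `above v a i` beats `y` for `i`. -/
theorem IsDoor.room_iff [DecidableEq U] {v : I → U → L}
    (hv : ∀ i, Function.Injective (v i)) {B : Finset U} {a : I → U} {i j : I}
    (h : IsDoor v B a i j) (y : U) :
    (y ∉ B ∧ Dominant v (insert y B) ∧ v i y < v i (a i)) ↔
      y ∈ above v a i ∧ ∀ z ∈ above v a i, v i z ≤ v i y := by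
  constructor
  · rintro ⟨hyB, hdom, hlt⟩
    refine ⟨fun l hl => ?_, fun z hz => ?_⟩
    · by_contra hcon
      have hlt' : v l y < v l (a l) := lt_of_le_of_ne (not_lt.1 hcon)
        fun he => hyB (by rw [hv l he]; exact h.mem l)
      obtain ⟨m, hm⟩ := hdom (a l)
      have hma : a m = a l := hv m (le_antisymm (h.le m _ (h.mem l))
        (hm _ (mem_insert_of_mem (h.mem m))))
      have hmy := hm y (mem_insert_self _ _)
      have hml : m ≠ l := by rintro rfl; exact absurd hmy (not_le.2 hlt')
      have hmi : m ≠ i := by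
        rintro rfl
        rw [← hma] at hmy
        exact absurd hmy (not_le.2 hlt)
      rcases h.pair m l hml hma with ⟨h1, -⟩ | ⟨-, h1⟩
      · exact hmi h1
      · exact hl h1
    · obtain ⟨m, hm⟩ := hdom z
      by_cases hmi : m = i
      · subst hmi
        exact hm y (mem_insert_self _ _)
      · exact absurd (hm _ (mem_insert_of_mem (h.mem m))) (not_le.2 (hz m hmi))
  · rintro ⟨hy, hmax⟩
    have hyB : y ∉ B := by
      intro hyB
      obtain ⟨k, rfl⟩ := h.surj y hyB
      by_cases hk : k = i
      · subst hk
        have := hy j h.ne.symm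
        rw [h.eq] at this
        exact lt_irrefl _ this
      · exact lt_irrefl _ (hy k hk)
    have hlt : v i y < v i (a i) := by
      obtain ⟨m, hm⟩ := h.dominant y
      have hmi : m = i := by
        by_contra hmi
        exact absurd (hm _ (h.mem m)) (not_le.2 (hy m hmi))
      subst hmi
      exact lt_of_le_of_ne (hm _ (h.mem m)) fun he => hyB (by rw [hv m he]; exact h.mem m)
    refine ⟨hyB, fun z => ?_, hlt⟩
    by_cases hz : z ∈ above v a i
    · refine ⟨i, fun x hx => ?_⟩
      rcases mem_insert.1 hx with rfl | hx
      · exact hmax z hz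
      · exact (hmax z hz).trans (hlt.le.trans (h.le i x hx))
    · simp only [above, Set.mem_ofPred_eq, not_forall, not_lt] at hz
      obtain ⟨l, hl, hzl⟩ := hz
      refine ⟨l, fun x hx => ?_⟩
      rcases mem_insert.1 hx with rfl | hx
      · exact hzl.trans (hy l hl).le
      · exact hzl.trans (h.le l x hx)

/-- If `y` is worst for `k`, dominance tested on `a k` shows that `a k` is still worst for another
index; hence `k` belongs to the pair sharing a worst element. -/
theorem IsDoor.lt_or_lt [DecidableEq U] {v : I → U → L}
    (hv : ∀ i, Function.Injective (v i)) {B : Finset U} {a : I → U} {i j : I}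
    (h : IsDoor v B a i j) {y : U} (hyB : y ∉ B) (hdom : Dominant v (insert y B)) :
    v i y < v i (a i) ∨ v j y < v j (a j) := by
  obtain ⟨k, hk⟩ := hdom y
  have hlt : v k y < v k (a k) := lt_of_le_of_ne (hk _ (mem_insert_of_mem (h.mem k)))
    fun he => hyB (by rw [hv k he]; exact h.mem k)
  obtain ⟨l, hl⟩ := hdom (a k)
  have hla : a l = a k := hv l (le_antisymm (h.le l _ (h.mem k))
    (hl _ (mem_insert_of_mem (h.mem l))))
  have hlk : l ≠ k := by
    rintro rfl
    exact absurd (hl y (mem_insert_self _ _)) (not_le.2 hlt)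
  rcases h.pair l k hlk hla with ⟨-, rfl⟩ | ⟨-, rfl⟩
  · exact Or.inr hlt
  · exact Or.inl hlt

open Classical in
/-- The elements that complete `B` to a dominant set. -/
noncomputable def completions [Fintype U] (v : I → U → L) (B : Finset U) : Finset U :=
  univ.filter fun u => u ∉ B ∧ Dominant v (insert u B)

open Classical in
theorem card_filter_isMax [Fintype U] {f : U → L} (hf : Function.Injective f) (Y : Set U) :
    (univ.filter fun y => y ∈ Y ∧ ∀ z ∈ Y, f z ≤ f y).card = if Y.Nonempty then 1 else 0 := by
  split_ifs with h
  · obtain ⟨y, hy, hmax⟩ := Set.exists_max_image Y f (Set.toFinite Y) h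
    rw [card_eq_one]
    refine ⟨y, ?_⟩
    ext z
    simp only [mem_filter, mem_univ, true_and, mem_singleton]
    constructor
    · rintro ⟨hz, hzmax⟩
      exact hf (le_antisymm (hmax z hz) (hzmax y hy))
    · rintro rfl
      exact ⟨hy, hmax⟩
  · rw [card_eq_zero]
    ext z
    simp only [mem_filter, mem_univ, true_and, notMem_empty, iff_false]
    exact fun hz => h ⟨z, hz.1⟩

open Classical in
theorem IsDoor.card_completions [Fintype U] {v : I → U → L}
    (hv : ∀ i, Function.Injective (v i)) {B : Finset U} {a : I → U} {i j : I}
    (h : IsDoor v B a i j) :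
    (completions v B).card = (if (above v a i).Nonempty then 1 else 0) +
      (if (above v a j).Nonempty then 1 else 0) := by
  rw [← card_filter_isMax (hv i) (above v a i), ← card_filter_isMax (hv j) (above v a j),
    ← card_union_of_disjoint]
  · congr 1
    ext y
    simp only [completions, mem_filter, mem_univ, true_and, mem_union]
    rw [← h.room_iff hv y, ← h.symm.room_iff hv y]
    constructor
    · rintro ⟨h1, h2⟩
      rcases h.lt_or_lt hv h1 h2 with h3 | h3
      · exact Or.inl ⟨h1, h2, h3⟩
      · exact Or.inr ⟨h1, h2, h3⟩
    · rintro (⟨h1, h2, -⟩ | ⟨h1, h2, -⟩) <;> exact ⟨h1, h2⟩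
  · rw [disjoint_left]
    intro y h1 h2
    simp only [mem_filter, mem_univ, true_and] at h1 h2
    have h3 := ((h.symm.room_iff hv y).2 h2).2.2
    exact lt_asymm h3 (h1.1 j h.ne.symm)

/-- The count is 2, as `s i` and `s j` lie in the two sets `above`: the presence of `x` prevents a
slack element from being worst for a foreign index. -/
theorem even_card_completions [Fintype I] [Fintype U] {v : I → U → L}
    (hv : ∀ i, Function.Injective (v i)) {s : I → U} (hs : IsSlack v s) {B : Finset U}
    (hB : Dominant v B) (hcard : B.card + 1 = Fintype.card I) {x : U} (hx : x ∈ B)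
    (hxs : x ∉ Set.range s) : Even (completions v B).card := by
  classical
  obtain ⟨a, i, j, h⟩ := hB.exists_isDoor hv ⟨x, hx⟩ hcard
  have key : ∀ i j, IsDoor v B a i j → (above v a i).Nonempty := by
    intro i j h
    refine ⟨s i, fun l hl => ?_⟩
    by_cases hal : a l ∈ Set.range s
    · obtain ⟨m, hm⟩ := hal
      by_cases hml : m = l
      · subst hml
        rw [← hm]
        exact hs.lt_of_ne m _ (hs.injective.ne hl.symm)
      · exact absurd (h.le l x hx) (not_le.2 (by rw [← hm]; exact hs.lt_of_notMem m l x hml hxs))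
    · exact hs.lt_of_notMem i l _ hl.symm hal
  rw [h.card_completions hv, if_pos (key i j h), if_pos (key j i h.symm)]
  exact ⟨1, rfl⟩

/-- This is the boundary door of the parity argument. Every index other than `i₀` has its own slack
element as worst one. All non-slack elements lie in `above v a i₀`, while the other set `above` is
empty: its members would have to beat a slack element `s j` for `i₀`, and the only candidates are
slack elements that are worst for their own index. -/
theorem card_completions_image_slack [Fintype I] [Nontrivial I] [DecidableEq I] [DecidableEq U]
    [Fintype U] {v : I → U → L} (hv : ∀ i, Function.Injective (v i)) {s : I → U}
    (hs : IsSlack v s) (i₀ : I)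
    (hB : Dominant v ((univ.erase i₀).image s)) {x : U} (hxs : x ∉ Set.range s) :
    (completions v ((univ.erase i₀).image s)).card = 1 := by
  obtain ⟨k₀, hk₀⟩ := exists_ne i₀
  obtain ⟨a, i, j, h⟩ := hB.exists_isDoor hv ⟨s k₀, mem_image_of_mem _ (by simp [hk₀])⟩ (by
    rw [card_image_of_injective _ hs.injective, card_erase_of_mem (mem_univ _), card_univ]
    have := Fintype.card_pos (α := I)
    omega)
  have ha : ∀ k, k ≠ i₀ → a k = s k := by
    intro k hk
    by_contra hne
    exact absurd (h.le k (s k) (mem_image_of_mem _ (by simp [hk])))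
      (not_le.2 (hs.lt_of_ne k _ hne))
  wlog hi : i = i₀ generalizing i j
  · refine this j i h.symm ?_
    by_contra hj
    have := h.eq
    rw [ha i hi, ha j hj] at this
    exact h.ne (hs.injective this)
  subst hi
  have hj : a j = s j := ha j h.ne.symm
  have h1 : (above v a i).Nonempty := by
    refine ⟨x, fun l hl => ?_⟩
    rw [ha l hl]
    exact hs.lt_of_ne l x fun he => hxs ⟨l, he.symm⟩
  have h2 : ¬ (above v a j).Nonempty := by
    rintro ⟨y, hy⟩
    have hyi := hy i h.ne
    rw [h.eq, hj] at hyi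
    by_cases hys : y ∈ Set.range s
    · obtain ⟨m, rfl⟩ := hys
      by_cases hmi : m = i
      · subst hmi
        exact lt_asymm hyi (hs.lt_of_ne m _ (hs.injective.ne h.ne.symm))
      · by_cases hmj : m = j
        · subst hmj
          exact lt_irrefl _ hyi
        · have := hy m hmj
          rw [ha m hmi] at this
          exact lt_irrefl _ this
    · exact lt_asymm hyi (hs.lt_of_notMem j i y h.ne.symm hys)
  rw [h.card_completions hv, if_pos h1, if_neg h2]

theorem dominant_image_slack [Fintype I] [DecidableEq I] [DecidableEq U]
    {v : I → U → L} {s : I → U} (hs : IsSlack v s) (i₀ : I) :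
    Dominant v ((univ.erase i₀).image s) := by
  intro y
  by_cases hy : y ∈ Set.range s
  · obtain ⟨j, rfl⟩ := hy
    refine ⟨j, fun x _ => ?_⟩
    by_cases hxj : x = s j
    · rw [hxj]
    · exact (hs.lt_of_ne j x hxj).le
  · refine ⟨i₀, fun x hx => ?_⟩
    obtain ⟨k, hk, rfl⟩ := mem_image.1 hx
    exact (hs.lt_of_notMem k i₀ y (mem_erase.1 hk).1 hy).le

/-- A set of `|I|` coloured elements in which not all colours of `I` occur has an even number of
elements whose removal leaves exactly the colours other than `i₀`. -/
theorem even_card_filter_image_erase [Fintype I] [DecidableEq I] [DecidableEq U]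
    (c : U → I) (i₀ : I) {A : Finset U} (hA : A.card = Fintype.card I)
    (hc : A.image c ≠ univ) :
    Even (A.filter fun x => (A.erase x).image c = univ.erase i₀).card := by
  rcases (A.filter fun x => (A.erase x).image c = univ.erase i₀).eq_empty_or_nonempty with h | ⟨x, hx⟩
  · rw [h]; exact ⟨0, rfl⟩
  rw [mem_filter] at hx
  obtain ⟨hxA, hx⟩ := hx
  have hinj : Set.InjOn c (A.erase x : Finset U) := by
    apply Finset.injOn_of_card_image_eq
    rw [hx, card_erase_of_mem (mem_univ _), card_erase_of_mem hxA, card_univ, hA]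
  have hcx : c x ≠ i₀ := by
    intro hcx
    apply hc
    rw [← insert_erase hxA, image_insert, hx, hcx, insert_erase (mem_univ _)]
  have hmem : c x ∈ (A.erase x).image c := by
    rw [hx]; simp [hcx]
  obtain ⟨x', hx', hcx'⟩ := mem_image.1 hmem
  have hxx' : x' ≠ x := (mem_erase.1 hx').1
  have : (A.filter fun x => (A.erase x).image c = univ.erase i₀) = {x, x'} := by
    ext y
    simp only [mem_filter, mem_insert, mem_singleton]
    constructor
    · rintro ⟨hyA, hy⟩
      by_contra hcon
      push Not at hcon
      have hyx : y ∈ A.erase x := mem_erase.2 ⟨hcon.1, hyA⟩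
      have hcy : c y ∈ (A.erase y).image c := by
        rw [hy, ← hx]
        exact mem_image_of_mem _ hyx
      obtain ⟨z, hz, hzy⟩ := mem_image.1 hcy
      rw [mem_erase] at hz
      by_cases hzx : z = x
      · subst hzx
        exact hcon.2 (hinj hyx hx' (by rw [← hzy, hcx']))
      · exact hz.1 (hinj (mem_coe.2 (mem_erase.2 ⟨hzx, hz.2⟩)) hyx hzy)
    · rintro (rfl | rfl)
      · exact ⟨hxA, hx⟩
      · refine ⟨(mem_erase.1 hx').2, ?_⟩
        rw [← hx]
        ext k
        simp only [mem_image, mem_erase]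
        constructor
        · rintro ⟨z, ⟨hz1, hz2⟩, rfl⟩
          by_cases hzx : z = x
          · exact ⟨y, ⟨hxx', (mem_erase.1 hx').2⟩, by rw [hcx', hzx]⟩
          · exact ⟨z, ⟨hzx, hz2⟩, rfl⟩
        · rintro ⟨z, ⟨hz1, hz2⟩, rfl⟩
          by_cases hzy : z = y
          · exact ⟨x, ⟨hxx'.symm, hxA⟩, by rw [hzy, hcx']⟩
          · exact ⟨z, ⟨hzy, hz2⟩, rfl⟩
  rw [this, card_pair hxx'.symm]
  exact ⟨1, rfl⟩

/-- **Scarf's combinatorial lemma**: some dominant set of size `|I|` contains all colours. -/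
theorem exists_dominant_image_eq_univ [Fintype I] [Nontrivial I] [DecidableEq I] [Fintype U]
    {v : I → U → L} (hv : ∀ i, Function.Injective (v i)) {s : I → U} (hs : IsSlack v s)
    {x₀ : U} (hx₀ : x₀ ∉ Set.range s) (c : U → I) (hc : ∀ i, c (s i) = i) :
    ∃ A : Finset U, Dominant v A ∧ A.card = Fintype.card I ∧ A.image c = univ := by
  classical
  by_contra hcon
  push Not at hcon
  obtain ⟨i₀⟩ : Nonempty I := inferInstance
  let rooms : Finset (Finset U) := univ.filter fun A => Dominant v A ∧ A.card = Fintype.card I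
  let doors : Finset (Finset U) := univ.filter fun B =>
    Dominant v B ∧ B.card + 1 = Fintype.card I ∧ B.image c = univ.erase i₀
  -- Pairs of a door inside a room are counted twice. If no room has all colours, every room
  -- contains an even number of doors; every door lies in an even number of rooms, except the door
  -- of slack elements, which lies in one.
  have hsum := sum_card_bipartiteAbove_eq_sum_card_bipartiteBelow (s := doors) (t := rooms)
    (fun B A => B ⊆ A)
  have hright : Even (∑ A ∈ rooms, (doors.bipartiteBelow (fun B A => B ⊆ A) A).card) := by
    refine Finset.even_sum _ fun A hA => ?_
    simp only [rooms, mem_filter, mem_univ, true_and] at hA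
    refine (congrArg Even ?_).mp (even_card_filter_image_erase c i₀ hA.2 (hcon A hA.1 hA.2))
    refine card_bij (fun x _ => A.erase x) ?_ ?_ ?_
    · intro x hx
      rw [mem_filter] at hx
      simp only [doors, mem_bipartiteBelow, mem_filter, mem_univ, true_and]
      refine ⟨⟨hA.1.mono (erase_subset _ _), ?_, hx.2⟩, erase_subset _ _⟩
      rw [card_erase_add_one hx.1, hA.2]
    · intro x hx y hy hxy
      exact erase_injOn A (mem_filter.1 hx).1 (mem_filter.1 hy).1 hxy
    · intro B hB
      simp only [doors, mem_bipartiteBelow, mem_filter, mem_univ, true_and] at hB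
      obtain ⟨⟨h1, h2, h3⟩, h4⟩ := hB
      obtain ⟨x, hx, rfl⟩ : ∃ x ∈ A, A.erase x = B := by
        have : (A \ B).card = 1 := by rw [card_sdiff_of_subset h4]; omega
        obtain ⟨x, hx⟩ := card_eq_one.1 this
        refine ⟨x, (mem_sdiff.1 (hx ▸ mem_singleton_self x)).1, ?_⟩
        rw [erase_eq, ← hx, Finset.sdiff_sdiff_eq_self h4]
      exact ⟨x, mem_filter.2 ⟨hx, h3⟩, rfl⟩
  have hcount : ∀ B ∈ doors,
      (rooms.bipartiteAbove (fun B A => B ⊆ A) B).card = (completions v B).card := by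
    intro B hB
    simp only [doors, mem_filter, mem_univ, true_and] at hB
    symm
    refine card_bij (fun x _ => insert x B) ?_ ?_ ?_
    · intro x hx
      simp only [completions, mem_filter, mem_univ, true_and] at hx
      simp only [rooms, mem_bipartiteAbove, mem_filter, mem_univ, true_and]
      refine ⟨⟨hx.2, ?_⟩, subset_insert _ _⟩
      rw [card_insert_of_notMem hx.1, hB.2.1]
    · intro x hx y hy hxy
      simp only [completions, mem_filter, mem_univ, true_and] at hx hy
      exact insert_inj_on' B (by simpa using hx.1) (by simpa using hy.1) hxy
    · intro A hA
      simp only [rooms, mem_bipartiteAbove, mem_filter, mem_univ, true_and] at hA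
      obtain ⟨⟨h1, h2⟩, h3⟩ := hA
      have : (A \ B).card = 1 := by rw [card_sdiff_of_subset h3]; omega
      obtain ⟨x, hx⟩ := card_eq_one.1 this
      have hxA := mem_sdiff.1 (hx ▸ mem_singleton_self x : x ∈ A \ B)
      have hins : insert x B = A := by
        rw [insert_eq, ← hx, sdiff_union_of_subset h3]
      refine ⟨x, ?_, hins⟩
      simp only [completions, mem_filter, mem_univ, true_and]
      exact ⟨hxA.2, hins ▸ h1⟩
  have hleft : Odd (∑ B ∈ doors, (rooms.bipartiteAbove (fun B A => B ⊆ A) B).card) := by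
    rw [sum_congr rfl hcount, odd_sum_iff_odd_card_odd]
    have : (doors.filter fun B => Odd (completions v B).card) = {(univ.erase i₀).image s} := by
      ext B
      simp only [mem_filter, mem_singleton, doors, mem_univ, true_and]
      constructor
      · rintro ⟨⟨h1, h2, h3⟩, h4⟩
        have hsub : ∀ x ∈ B, x ∈ Set.range s := by
          intro x hx
          by_contra hxs
          exact Nat.not_even_iff_odd.2 h4 (even_card_completions hv hs h1 h2 hx hxs)
        have hBs : ∀ x ∈ B, s (c x) = x := by
          intro x hx
          obtain ⟨k, rfl⟩ := hsub x hx
          rw [hc]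
        rw [← h3, image_image]
        ext x
        simp only [mem_image, Function.comp]
        constructor
        · exact fun hx => ⟨x, hx, hBs x hx⟩
        · rintro ⟨y, hy, rfl⟩
          rwa [hBs y hy]
      · rintro rfl
        have hd := dominant_image_slack hs i₀
        refine ⟨⟨hd, ?_, ?_⟩, ?_⟩
        · rw [card_image_of_injective _ hs.injective, card_erase_add_one (mem_univ _), card_univ]
        · rw [image_image]
          rw [show c ∘ s = id from funext hc, image_id]
        · rw [card_completions_image_slack hv hs i₀ hd hx₀]
          exact odd_one
    rw [this, card_singleton]
    exact odd_one
  rw [hsum] at hleft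
  exact Nat.not_even_iff_odd.2 hleft hright

end Scarf

/-! ### A KKM theorem for open covers of the simplex. -/

section KKM

variable {I : Type*} [Fintype I]

/-- In a colouring of the grid points of the simplex there are a set `C` of colours and grid
points of these colours that are close to each other and to the face spanned by `C`. -/
theorem exists_close_grid_points [Nontrivial I] (N : ℕ) (c : (I → ℕ) → I) :
    ∃ (C : Finset I) (x : I → I → ℕ), C.Nonempty ∧ (∀ i ∈ C, ∑ k, x i k = N ∧ c (x i) = i) ∧
      (∀ i ∈ C, ∀ j ∈ C, ∀ k, x i k < x j k + Fintype.card I) ∧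
      ∀ i ∈ C, ∀ k, k ∉ C → x i k < Fintype.card I := by
  classical
  let X := {a : I → ℕ // a ∈ Finset.piAntidiag univ N}
  have hX : ∀ a : X, ∑ k, a.1 k = N := fun a => (mem_piAntidiag.1 a.2).1
  let U := X ⊕ I
  have : Fintype X := Finset.Subtype.fintype _
  have : Fintype U := instFintypeSum X I
  -- The slack element `j` lies below all grid points for `j` and above them for every other index.
  -- The second lexicographic component in `v` only breaks ties.
  let f : I → U → ℤ := fun i u => Sum.elim (fun a : X => (a.1 i : ℤ))
    (fun j => if j = i then -1 else N + 1) u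
  let v : I → U → ℤ ×ₗ Fin (Fintype.card U) := fun i u => toLex (f i u, Fintype.equivFin U u)
  have hlt : ∀ i u u', f i u < f i u' → v i u < v i u' := fun i u u' h => Prod.Lex.left _ _ h
  have hle : ∀ i u u', v i u ≤ v i u' → f i u ≤ f i u' := by
    intro i u u' h
    by_contra hcon
    exact absurd h (not_le.2 (hlt i _ _ (not_le.1 hcon)))
  have hXle : ∀ (a : X) i, a.1 i ≤ N := by
    intro a i
    refine le_of_le_of_eq ?_ (hX a)
    exact single_le_sum (f := a.1) (fun _ _ => Nat.zero_le _) (mem_univ i)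
  have hv : ∀ i, Function.Injective (v i) := by
    intro i u u' h
    have := congrArg (fun z => (ofLex z).2) h
    exact (Fintype.equivFin U).injective this
  have hs : IsSlack v (Sum.inr : I → U) := by
    refine ⟨Sum.inr_injective, ?_, ?_⟩
    · rintro i (a | j) hu
      · apply hlt
        simp only [f, Sum.elim_inl, Sum.elim_inr, if_true]
        omega
      · apply hlt
        have : j ≠ i := fun h => hu (by rw [h])
        simp only [f, Sum.elim_inr, if_true, if_neg this]
        omega
    · rintro i k (a | j) hik hu
      · apply hlt
        have := hXle a k
        simp only [f, Sum.elim_inl, Sum.elim_inr, if_neg hik]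
        omega
      · exact absurd ⟨j, rfl⟩ hu
  obtain ⟨i₀⟩ : Nonempty I := inferInstance
  let x₀ : X := ⟨Pi.single i₀ N, by simp⟩
  obtain ⟨A, hA, -, hcol⟩ := exists_dominant_image_eq_univ hv hs (x₀ := Sum.inl x₀)
    (by rintro ⟨j, hj⟩; exact absurd hj (by simp)) (Sum.elim (fun a => c a.1) id) (fun i => rfl)
  -- For `i ∈ C` the colour `i` must come from a grid point of `A`. For the other indices the slack
  -- value `-1` in `A` rules out that dominance over a grid point is witnessed there.
  let C : Finset I := univ.filter fun i => (Sum.inr i : U) ∉ A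
  have hdom : ∀ y : X, ∃ i ∈ C, ∀ a : X, (Sum.inl a : U) ∈ A → y.1 i ≤ a.1 i := by
    intro y
    obtain ⟨i, hi⟩ := hA (Sum.inl y)
    refine ⟨i, ?_, ?_⟩
    · simp only [C, mem_filter, mem_univ, true_and]
      intro hiA
      have := hle i _ _ (hi _ hiA)
      simp only [f, Sum.elim_inl, Sum.elim_inr, if_true] at this
      omega
    · intro a ha
      have := hle i _ _ (hi _ ha)
      simp only [f, Sum.elim_inl] at this
      exact_mod_cast this
  have hex : ∀ i, ∃ a : X, i ∈ C → (Sum.inl a : U) ∈ A ∧ c a.1 = i := by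
    intro i
    by_cases hi : i ∈ C
    · have : i ∈ A.image (Sum.elim (fun a : X => c a.1) id) := by rw [hcol]; exact mem_univ i
      obtain ⟨u, hu, hui⟩ := mem_image.1 this
      rcases u with a | j
      · exact ⟨a, fun _ => ⟨hu, hui⟩⟩
      · simp only [Sum.elim_inr, id] at hui
        subst hui
        exact absurd hu (mem_filter.1 hi).2
    · exact ⟨x₀, fun h => absurd h hi⟩
  choose x hx using hex
  have hCne : C.Nonempty := by
    obtain ⟨i, hi, -⟩ := hdom x₀
    exact ⟨i, hi⟩
  let b : I → ℕ := fun i => C.inf' hCne fun j => (x j).1 i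
  have hb : ∀ i, ∀ j ∈ C, b i ≤ (x j).1 i := fun i j hj => inf'_le _ hj
  -- Otherwise some grid point exceeds `b` at every coordinate in `C`, the surplus going to one of
  -- them, against `hdom`. Consequently each `x j` has less than `|C|` to spend beyond the minima
  -- `b`.
  have hsum : N < ∑ i ∈ C, (b i + 1) := by
    by_contra hcon
    push Not at hcon
    obtain ⟨i₁, hi₁⟩ := hCne
    let y : I → ℕ := fun i => (if i ∈ C then b i + 1 else 0) +
      if i = i₁ then N - ∑ i ∈ C, (b i + 1) else 0
    have hy : ∑ i, y i = N := by
      simp only [y, sum_add_distrib, sum_ite_eq', mem_univ, if_true]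
      rw [← sum_filter, filter_mem_eq_inter, univ_inter]
      simp only [sum_add_distrib] at hcon ⊢
      omega
    obtain ⟨i, hi, hyi⟩ := hdom ⟨y, by rw [mem_piAntidiag]; exact ⟨hy, fun _ _ => mem_univ _⟩⟩
    have h1 : y i ≤ b i := le_inf' _ _ fun j hj => hyi (x j) (hx j hj).1
    simp only [y, if_pos hi] at h1
    omega
  have hcard : C.card ≤ Fintype.card I := card_le_univ C
  rw [sum_add_distrib, sum_const, smul_eq_mul, mul_one] at hsum
  have hsmall : ∀ j ∈ C, ∀ k, k ∉ C → (x j).1 k < Fintype.card I := by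
    intro j hj k hk
    have h1 : ∑ i ∈ C, b i ≤ ∑ i ∈ C, (x j).1 i := sum_le_sum fun i _ => hb i j hj
    have h2 : ∑ i ∈ insert k C, (x j).1 i ≤ N := by
      exact le_of_le_of_eq (sum_le_sum_of_subset (subset_univ _)) (hX (x j))
    rw [sum_insert hk] at h2
    omega
  refine ⟨C, fun i => (x i).1, hCne, fun i hi => ⟨hX _, (hx i hi).2⟩, ?_, hsmall⟩
  intro i hi j hj k
  by_cases hk : k ∈ C
  · have h1 : ∑ l ∈ C.erase k, b l ≤ ∑ l ∈ C.erase k, (x i).1 l :=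
      sum_le_sum fun l _ => hb l i hi
    have h2 : ∑ l ∈ C, (x i).1 l ≤ N := by
      exact le_of_le_of_eq (sum_le_sum_of_subset (subset_univ _)) (hX (x i))
    rw [← add_sum_erase _ _ hk] at h2 hsum
    have h3 := hb k j hj
    show (x i).1 k < (x j).1 k + _
    omega
  · have := hsmall i hi k hk
    show (x i).1 k < (x j).1 k + _
    omega

/-- A **KKM theorem**: if open sets `U i` cover the simplex, then some point of the simplex lies in
`U i` for every `i` in its support. -/
theorem exists_mem_of_support_of_isOpen_cover [Nonempty I] (U : I → Set (I → ℝ))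
    (hU : ∀ i, IsOpen (U i)) (hcov : stdSimplex ℝ I ⊆ ⋃ i, U i) :
    ∃ w ∈ stdSimplex ℝ I, ∀ i, w i ≠ 0 → w ∈ U i := by
  classical
  rcases subsingleton_or_nontrivial I with hI | hI
  · obtain ⟨i₀⟩ : Nonempty I := inferInstance
    have h1 := single_mem_stdSimplex ℝ i₀
    refine ⟨_, h1, fun i _ => ?_⟩
    obtain ⟨j, hj⟩ := Set.mem_iUnion.1 (hcov h1)
    rwa [Subsingleton.elim i j]
  obtain ⟨δ, hδ, hleb⟩ := lebesgue_number_lemma_of_metric (isCompact_stdSimplex ℝ I) hU hcov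
  set n : ℕ := Fintype.card I with hn
  -- `n * n / N` bounds the change of a coordinate when the mass of `x j` outside `C` is moved to
  -- `j`, and `n / N` bounds the distance between two of the scaled grid points.
  obtain ⟨N, hN⟩ := exists_nat_gt (((n : ℝ) * n + n) / δ)
  have hN0 : (0 : ℝ) < N := lt_of_le_of_lt (by positivity) hN
  have hNδ : ((n : ℝ) * n + n) / N < δ := by
    rw [div_lt_iff₀ hδ] at hN
    rw [div_lt_iff₀ hN0]
    linarith [mul_comm (N : ℝ) δ]
  have hmem : ∀ a : I → ℕ, ∑ k, a k = N → (fun k => (a k : ℝ) / N) ∈ stdSimplex ℝ I := by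
    intro a ha
    refine ⟨fun k => by positivity, ?_⟩
    rw [← sum_div, ← Nat.cast_sum, ha, div_self hN0.ne']
  have hcol : ∀ a : I → ℕ, ∃ i, ∑ k, a k = N →
      Metric.ball (fun k => (a k : ℝ) / N) δ ⊆ U i := by
    intro a
    by_cases ha : ∑ k, a k = N
    · obtain ⟨i, hi⟩ := hleb _ (hmem a ha)
      exact ⟨i, fun _ => hi⟩
    · exact ⟨Classical.arbitrary I, fun h => absurd h ha⟩
  choose c hc using hcol
  obtain ⟨C, x, ⟨j, hj⟩, hx, hclose, hsmall⟩ := exists_close_grid_points N c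
  let R : ℝ := ∑ k ∈ univ.filter (· ∉ C), (x j k : ℝ) / N
  have hR0 : 0 ≤ R := sum_nonneg fun _ _ => by positivity
  have hR : R ≤ (n : ℝ) * n / N := by
    calc R ≤ ∑ k ∈ univ.filter (· ∉ C), (n : ℝ) / N := by
          refine sum_le_sum fun k hk => ?_
          have : x j k ≤ n := (hsmall j hj k (mem_filter.1 hk).2).le
          gcongr
      _ = ((univ.filter (· ∉ C)).card : ℝ) * (n / N) := by rw [sum_const, nsmul_eq_mul]
      _ ≤ (n : ℝ) * (n / N) := by
          have : (univ.filter (· ∉ C)).card ≤ n := card_le_univ _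
          gcongr
      _ = _ := by ring
  let w : I → ℝ := fun k => (if k ∈ C then (x j k : ℝ) / N else 0) + if k = j then R else 0
  have hw : w ∈ stdSimplex ℝ I := by
    refine ⟨fun k => ?_, ?_⟩
    · have h1 : (0 : ℝ) ≤ (x j k : ℝ) / N := by positivity
      simp only [w]
      split_ifs <;> linarith
    · simp only [w, sum_add_distrib, sum_ite_eq', mem_univ, if_true]
      rw [← sum_filter]
      simp only [R]
      rw [sum_filter_add_sum_filter_not]
      exact (hmem (x j) (hx j hj).1).2
  refine ⟨w, hw, fun i hi => ?_⟩
  have hiC : i ∈ C := by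
    by_contra hiC
    apply hi
    have : i ≠ j := fun h => hiC (h ▸ hj)
    simp [w, hiC, this]
  have hball := hc (x i) (hx i hiC).1
  rw [(hx i hiC).2] at hball
  apply hball
  rw [Metric.mem_ball]
  refine lt_of_le_of_lt ((dist_pi_le_iff (by positivity)).2 fun k => ?_) hNδ
  have hdist : |(x j k : ℝ) / N - (x i k : ℝ) / N| ≤ n / N := by
    rw [← sub_div, abs_div, abs_of_pos hN0]
    have h1 : (x j k : ℝ) ≤ x i k + n := by exact_mod_cast (hclose j hj i hiC k).le
    have h2 : (x i k : ℝ) ≤ x j k + n := by exact_mod_cast (hclose i hiC j hj k).le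
    have : |(x j k : ℝ) - x i k| ≤ n := abs_le.2 ⟨by linarith, by linarith⟩
    gcongr
  have hwx : |w k - (x j k : ℝ) / N| ≤ n * n / N := by
    have hjk : k ∉ C → k ≠ j := fun h h' => h (h' ▸ hj)
    by_cases hk : k ∈ C
    · simp only [w, if_pos hk]
      split_ifs
      · rw [add_sub_cancel_left, abs_of_nonneg hR0]
        exact hR
      · rw [add_zero, sub_self, abs_zero]
        positivity
    · simp only [w, if_neg hk, if_neg (hjk hk)]
      rw [add_zero, zero_sub, abs_neg, abs_of_nonneg (by positivity)]
      refine le_trans (single_le_sum (f := fun k => (x j k : ℝ) / N) (fun _ _ => by positivity)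
        (mem_filter.2 ⟨mem_univ k, hk⟩)) hR
  rw [Real.dist_eq, add_div]
  calc |w k - (x i k : ℝ) / N| ≤ |w k - (x j k : ℝ) / N| + |(x j k : ℝ) / N - (x i k : ℝ) / N| :=
        abs_sub_le _ _ _
    _ ≤ _ := add_le_add hwx hdist

end KKM

/-! ### Fractional matchings and Füredi's theorem. -/

section FractionalMatching

variable {ι α : Type*} [Fintype ι] [DecidableEq α]

/-- The total weight of the sets of the family that contain `a`. -/
def load (S : ι → Finset α) (y : ι → ℝ) (a : α) : ℝ :=
  ∑ i, if a ∈ S i then y i else 0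

/-- Fractional matchings of a finite family of finite sets. -/
structure IsFractionalMatching (S : ι → Finset α) (y : ι → ℝ) : Prop where
  nonneg : ∀ i, 0 ≤ y i
  load_le : ∀ a, load S y a ≤ 1

theorem load_add_mul (S : ι → Finset α) (y z : ι → ℝ) (t : ℝ) (a : α) :
    load S (fun i => y i + t * z i) a = load S y a + t * load S z a := by
  simp only [load, mul_sum, ← sum_add_distrib]
  refine sum_congr rfl fun i _ => ?_
  split_ifs <;> simp

theorem sum_load (S : ι → Finset α) (y : ι → ℝ) (B : Finset α) :
    ∑ a ∈ B, load S y a = ∑ i, ((B ∩ S i).card : ℝ) * y i := by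
  simp only [load]
  rw [sum_comm]
  refine sum_congr rfl fun i _ => ?_
  rw [← sum_filter, filter_mem_eq_inter, sum_const, nsmul_eq_mul]

/-- The slack variables of the linear program of fractional matchings. -/
def slackness (S : ι → Finset α) (y : ι → ℝ) : ι ⊕ α → ℝ :=
  Sum.elim y fun a => 1 - load S y a

theorem isFractionalMatching_iff (S : ι → Finset α) (y : ι → ℝ) :
    IsFractionalMatching S y ↔ ∀ k, 0 ≤ slackness S y k := by
  constructor
  · rintro ⟨h1, h2⟩ (i | a)
    · exact h1 i
    · exact sub_nonneg.2 (h2 a)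
  · intro h
    exact ⟨fun i => h (Sum.inl i), fun a => sub_nonneg.1 (h (Sum.inr a))⟩

/-- Moving along a direction that decreases some of finitely many nonnegative quantities until the
first of them vanishes. -/
theorem exists_first_zero {κ : Type*} [Fintype κ] (p q : κ → ℝ) (hp : ∀ k, 0 ≤ p k)
    (hq : ∃ k, q k < 0) :
    ∃ t : ℝ, 0 ≤ t ∧ (∀ k, 0 ≤ p k + t * q k) ∧ ∃ k, q k < 0 ∧ p k + t * q k = 0 := by
  classical
  obtain ⟨k₀, hk₀⟩ := hq
  obtain ⟨k, hk, hmin⟩ := exists_min_image (univ.filter fun k => q k < 0) (fun k => p k / -q k)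
    ⟨k₀, by simpa using hk₀⟩
  simp only [mem_filter, mem_univ, true_and] at hk hmin
  have ht : 0 ≤ p k / -q k := div_nonneg (hp k) (by linarith)
  refine ⟨p k / -q k, ht, fun l => ?_, k, hk, ?_⟩
  · by_cases hl : q l < 0
    · have := hmin l hl
      rw [le_div_iff₀ (by linarith)] at this
      linarith
    · have := mul_nonneg ht (not_lt.1 hl)
      linarith [hp l]
  · have : q k ≠ 0 := hk.ne
    field_simp
    ring

/-- If there are fewer tight vertices than sets of positive weight, the weights can be changed in
a direction that does not affect the tight vertices. -/
theorem exists_direction [Fintype α] (S : ι → Finset α) (y : ι → ℝ)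
    (h : (univ.filter fun a => load S y a = 1).card < (univ.filter fun i => y i ≠ 0).card) :
    ∃ z : ι → ℝ, z ≠ 0 ∧ (∀ i, y i = 0 → z i = 0) ∧ (∀ a, load S y a = 1 → load S z a = 0) ∧
      0 ≤ ∑ i, z i := by
  classical
  let ext : ({i // y i ≠ 0} → ℝ) → ι → ℝ := fun f i => if hi : y i ≠ 0 then f ⟨i, hi⟩ else 0
  let Φ : ({i // y i ≠ 0} → ℝ) →ₗ[ℝ] ({a // load S y a = 1} → ℝ) :=
    { toFun := fun f a => load S (ext f) a
      map_add' := by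
        intro f g
        funext a
        show load S (ext (f + g)) a = load S (ext f) a + load S (ext g) a
        simp only [load, ext]
        rw [← sum_add_distrib]
        refine sum_congr rfl fun i _ => ?_
        split_ifs <;> simp
      map_smul' := by
        intro r f
        funext a
        show load S (ext (r • f)) a = r * load S (ext f) a
        simp only [load, ext]
        rw [mul_sum]
        refine sum_congr rfl fun i _ => ?_
        split_ifs <;> simp }
  have hker : LinearMap.ker Φ ≠ ⊥ := by
    apply LinearMap.ker_ne_bot_of_finrank_lt
    rwa [Module.finrank_fintype_fun_eq_card, Module.finrank_fintype_fun_eq_card,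
      Fintype.card_subtype, Fintype.card_subtype]
  obtain ⟨f, hf, hf0⟩ := Submodule.exists_mem_ne_zero_of_ne_bot hker
  have hz0 : ext f ≠ 0 := by
    intro h0
    apply hf0
    funext ⟨i, hi⟩
    have := congrFun h0 i
    simp only [ext, dif_pos hi] at this
    exact this
  have hsupp : ∀ i, y i = 0 → ext f i = 0 := fun i hi => by simp [ext, hi]
  have hload : ∀ a, load S y a = 1 → load S (ext f) a = 0 := fun a ha =>
    congrFun (LinearMap.mem_ker.1 hf) ⟨a, ha⟩
  rcases le_total 0 (∑ i, ext f i) with hs | hs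
  · exact ⟨ext f, hz0, hsupp, hload, hs⟩
  · refine ⟨-ext f, neg_ne_zero.2 hz0, fun i hi => by simp [hsupp i hi], fun a ha => ?_, ?_⟩
    · rw [← neg_eq_zero, ← hload a ha]
      simp only [load]
      rw [← sum_neg_distrib]
      refine sum_congr rfl fun i _ => ?_
      split_ifs <;> simp
    · simpa using hs

/-- Every fractional matching is dominated by one with at least as many tight vertices as
sets of positive weight. -/
theorem IsFractionalMatching.exists_basic [Fintype α] {S : ι → Finset α}
    (hS : ∀ i, (S i).Nonempty) {y : ι → ℝ} (hy : IsFractionalMatching S y) :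
    ∃ y', IsFractionalMatching S y' ∧ ∑ i, y i ≤ ∑ i, y' i ∧ (∀ i, y i = 0 → y' i = 0) ∧
      (univ.filter fun i => y' i ≠ 0).card ≤ (univ.filter fun a => load S y' a = 1).card := by
  classical
  induction hm : (univ.filter fun k => slackness S y k ≠ 0).card using Nat.strong_induction_on
    generalizing y with
  | _ m ih =>
    subst hm
    by_cases h : (univ.filter fun i => y i ≠ 0).card ≤ (univ.filter fun a => load S y a = 1).card
    · exact ⟨y, hy, le_rfl, fun _ => id, h⟩
    obtain ⟨z, hz0, hzsupp, hzload, hzsum⟩ := exists_direction S y (not_le.1 h)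
    let q : ι ⊕ α → ℝ := Sum.elim z fun a => - load S z a
    -- A direction that decreases no slack variable is nonnegative with nonpositive loads, hence
    -- zero because the sets are nonempty.
    have hq : ∃ k, q k < 0 := by
      by_contra hcon
      push Not at hcon
      obtain ⟨i, hi⟩ := Function.ne_iff.1 hz0
      obtain ⟨a, ha⟩ := hS i
      have h1 : load S z a ≤ 0 := neg_nonneg.1 (hcon (Sum.inr a))
      have h2 : z i ≤ load S z a := by
        have : z i = if a ∈ S i then z i else 0 := by rw [if_pos ha]
        rw [this]
        refine single_le_sum (f := fun i => if a ∈ S i then z i else 0) (fun j _ => ?_) (mem_univ i)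
        have := hcon (Sum.inl j)
        show 0 ≤ if a ∈ S j then z j else 0
        split_ifs
        · exact this
        · exact le_rfl
      have h3 : 0 ≤ z i := hcon (Sum.inl i)
      exact hi (le_antisymm (h2.trans h1) h3)
    obtain ⟨t, ht, hfeas, k₀, hk₀, hk₀0⟩ :=
      exists_first_zero (slackness S y) q ((isFractionalMatching_iff S y).1 hy) hq
    have hslack : ∀ k, slackness S (fun i => y i + t * z i) k = slackness S y k + t * q k := by
      rintro (i | a)
      · rfl
      · simp only [slackness, q, Sum.elim_inr, load_add_mul]
        ring
    have hqz : ∀ k, slackness S y k = 0 → q k = 0 := by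
      rintro (i | a) hk
      · exact hzsupp i hk
      · have : load S y a = 1 := (sub_eq_zero.1 hk).symm
        simp [q, hzload a this]
    have hlt : (univ.filter fun k => slackness S (fun i => y i + t * z i) k ≠ 0).card <
        (univ.filter fun k => slackness S y k ≠ 0).card := by
      apply card_lt_card
      rw [ssubset_iff_of_subset]
      · refine ⟨k₀, ?_, ?_⟩
        · simp only [mem_filter, mem_univ, true_and]
          intro h0
          exact hk₀.ne (hqz k₀ h0)
        · simp [hslack, hk₀0]
      · intro k hk
        simp only [mem_filter, mem_univ, true_and] at hk ⊢
        intro h0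
        apply hk
        rw [hslack, h0, hqz k h0]
        simp
    obtain ⟨y', h1, h2, h3, h4⟩ := ih _ hlt (y := fun i => y i + t * z i)
      ((isFractionalMatching_iff _ _).2 fun k => by rw [hslack]; exact hfeas k) rfl
    refine ⟨y', h1, le_trans ?_ h2, fun i hi => h3 i ?_, h4⟩
    · rw [sum_add_distrib, ← mul_sum]
      linarith [mul_nonneg ht hzsum]
    · simp [hi, hzsupp i hi]

/-- For a basic solution the support is no larger than the set of tight vertices, whose number is at
most `d` times the total weight by double counting. Weights all below `1 / d` would make the total
less than the size of the support divided by `d`. -/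
theorem IsFractionalMatching.exists_inv_le [Fintype α] {S : ι → Finset α}
    (hS : ∀ i, (S i).Nonempty) {d : ℕ} (hd : ∀ i, (S i).card ≤ d)
    {y : ι → ℝ} (hy : IsFractionalMatching S y) (hpos : 0 < ∑ i, y i) :
    ∃ y', IsFractionalMatching S y' ∧ ∑ i, y i ≤ ∑ i, y' i ∧ (∀ i, y i = 0 → y' i = 0) ∧
      ∃ i, 1 / (d : ℝ) ≤ y' i := by
  classical
  obtain ⟨y', h1, h2, h3, h4⟩ := hy.exists_basic hS
  refine ⟨y', h1, h2, h3, ?_⟩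
  by_contra hcon
  push Not at hcon
  have hpos' := hpos.trans_le h2
  obtain ⟨i₀, -, hi₀⟩ := exists_ne_zero_of_sum_ne_zero hpos'.ne'
  have hd0 : (0 : ℝ) < d := by
    have := (card_pos.2 (hS i₀)).trans_le (hd i₀)
    exact_mod_cast this
  have hnonneg : ∀ a, 0 ≤ load S y' a := fun a => sum_nonneg fun i _ => by
    split_ifs
    · exact h1.nonneg i
    · exact le_rfl
  have htight : ((univ.filter fun a => load S y' a = 1).card : ℝ) ≤ d * ∑ i, y' i := by
    calc ((univ.filter fun a => load S y' a = 1).card : ℝ)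
        = ∑ a ∈ univ.filter (fun a => load S y' a = 1), load S y' a := by
          rw [sum_congr rfl fun a ha => (mem_filter.1 ha).2, sum_const, nsmul_eq_mul, mul_one]
      _ ≤ ∑ a, load S y' a := sum_le_sum_of_subset_of_nonneg (subset_univ _) fun a _ _ => hnonneg a
      _ = ∑ i, ((univ ∩ S i).card : ℝ) * y' i := sum_load S y' univ
      _ ≤ ∑ i, (d : ℝ) * y' i := by
          refine sum_le_sum fun i _ => mul_le_mul_of_nonneg_right ?_ (h1.nonneg i)
          rw [univ_inter]
          exact_mod_cast hd i
      _ = _ := by rw [mul_sum]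
  have hlt : ∑ i, y' i < (univ.filter fun i => y' i ≠ 0).card * (1 / (d : ℝ)) := by
    rw [← nsmul_eq_mul, ← sum_const, ← sum_filter_ne_zero]
    exact sum_lt_sum_of_nonempty ⟨i₀, by simpa using hi₀⟩ fun i _ => hcon i
  have h4' : ((univ.filter fun i => y' i ≠ 0).card : ℝ) ≤ d * ∑ i, y' i :=
    le_trans (by exact_mod_cast h4) htight
  rw [mul_one_div, lt_div_iff₀ hd0] at hlt
  linarith [mul_comm (d : ℝ) (∑ i, y' i)]

/-- **Füredi's theorem**: a family of nonempty sets of size at most `d` with a fractional matching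
of total weight more than `(d - 1 + 1 / d) * j` has `j + 1` pairwise disjoint members. -/
theorem IsFractionalMatching.exists_pairwiseDisjoint [Fintype α] {S : ι → Finset α}
    (hS : ∀ i, (S i).Nonempty) {d : ℕ} (hd1 : 1 ≤ d) (hd : ∀ i, (S i).card ≤ d) (j : ℕ)
    {y : ι → ℝ} (hy : IsFractionalMatching S y)
    (hj : ((d : ℝ) - 1 + 1 / d) * j < ∑ i, y i) :
    ∃ J : Finset ι, J.card = j + 1 ∧ (∀ i ∈ J, y i ≠ 0) ∧
      (J : Set ι).PairwiseDisjoint S := by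
  classical
  induction j generalizing y with
  | zero =>
    simp only [Nat.cast_zero, mul_zero] at hj
    obtain ⟨i₀, -, hi₀⟩ := exists_ne_zero_of_sum_ne_zero hj.ne'
    exact ⟨{i₀}, by simp, by simpa using hi₀, by simp⟩
  | succ j ih =>
    have hd1 : (1 : ℝ) ≤ d := by exact_mod_cast hd1
    have hd0 : (0 : ℝ) < d := by linarith
    have hc : (0 : ℝ) ≤ (d : ℝ) - 1 + 1 / d := by
      have : (0 : ℝ) ≤ 1 / d := by positivity
      linarith
    have hpos : 0 < ∑ i, y i := lt_of_le_of_lt (mul_nonneg hc (Nat.cast_nonneg _)) hj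
    obtain ⟨y', hy', hle, hsupp, i₀, hi₀⟩ := hy.exists_inv_le hS hd hpos
    have hs1 : 1 ≤ (S i₀).card := card_pos.2 (hS i₀)
    -- With `s = |S i₀|`, the loads over `S i₀` sum to at most `s` and count `y' i₀ ≥ 1 / d` with
    -- multiplicity `s`. So the sets meeting `S i₀` weigh at most `s - (s - 1) / d ≤ d - 1 + 1 / d`.
    have hmeet : ∑ i ∈ univ.filter (fun i => ¬ Disjoint (S i₀) (S i)), y' i ≤
        (d : ℝ) - 1 + 1 / d := by
      have h1 : ∑ a ∈ S i₀, load S y' a ≤ (S i₀).card := by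
        refine (sum_le_sum fun a _ => hy'.load_le a).trans ?_
        simp
      rw [sum_load] at h1
      have h2 : ∑ i ∈ univ.filter (fun i => ¬ Disjoint (S i₀) (S i)), y' i +
          (((S i₀).card : ℝ) - 1) * y' i₀ ≤ ∑ i, ((S i₀ ∩ S i).card : ℝ) * y' i := by
        have h3 : (((S i₀).card : ℝ) - 1) * y' i₀ =
            ∑ i, if i = i₀ then (((S i₀).card : ℝ) - 1) * y' i else 0 := by simp
        rw [sum_filter, h3, ← sum_add_distrib]
        refine sum_le_sum fun i _ => ?_
        by_cases hi : i = i₀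
        · subst hi
          have : ¬ Disjoint (S i) (S i) := by
            rw [disjoint_self]
            exact (hS i).ne_empty
          rw [if_pos this, if_pos rfl, inter_self]
          linarith
        · rw [if_neg hi, add_zero]
          split_ifs with hdis
          · exact mul_nonneg (Nat.cast_nonneg _) (hy'.nonneg i)
          · have : 1 ≤ (S i₀ ∩ S i).card := by
              rw [Nat.one_le_iff_ne_zero, ne_eq, card_eq_zero, ← disjoint_iff_inter_eq_empty]
              exact hdis
            have : (1 : ℝ) ≤ (S i₀ ∩ S i).card := by exact_mod_cast this
            linarith [mul_le_mul_of_nonneg_right this (hy'.nonneg i)]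
      have hs1' : (0 : ℝ) ≤ ((S i₀).card : ℝ) - 1 := by
        rw [sub_nonneg]; exact_mod_cast hs1
      have hsd : ((S i₀).card : ℝ) ≤ d := by exact_mod_cast hd i₀
      have h3 := mul_le_mul_of_nonneg_left hi₀ hs1'
      have h4 : ((d : ℝ) - (S i₀).card) * (1 / d) ≤ (d : ℝ) - (S i₀).card :=
        mul_le_of_le_one_right (by linarith) (by rw [div_le_one hd0]; exact hd1)
      have h5 : (d : ℝ) * (1 / d) = 1 := mul_one_div_cancel hd0.ne'
      nlinarith
    let y'' : ι → ℝ := fun i => if Disjoint (S i₀) (S i) then y' i else 0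
    have hy''le : ∀ i, y'' i ≤ y' i := fun i => by
      simp only [y'']
      split_ifs
      · exact le_rfl
      · exact hy'.nonneg i
    have hy'' : IsFractionalMatching S y'' := by
      refine ⟨fun i => ?_, fun a => le_trans (sum_le_sum fun i _ => ?_) (hy'.load_le a)⟩
      · simp only [y'']
        split_ifs
        · exact hy'.nonneg i
        · exact le_rfl
      · split_ifs
        · exact hy''le i
        · exact le_rfl
    have hsum : ∑ i, y'' i + ∑ i ∈ univ.filter (fun i => ¬ Disjoint (S i₀) (S i)), y' i =
        ∑ i, y' i := by
      simp only [y'']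
      rw [← sum_filter, sum_filter_add_sum_filter_not]
    obtain ⟨J, hJcard, hJ0, hJ⟩ := ih hy'' (by push_cast at hj; linarith)
    have hJdis : ∀ i ∈ J, Disjoint (S i₀) (S i) := by
      intro i hi
      by_contra hcon
      exact hJ0 i hi (by simp [y'', hcon])
    have hi₀J : i₀ ∉ J := by
      intro h
      have := hJdis i₀ h
      rw [disjoint_self] at this
      exact (hS i₀).ne_empty this
    refine ⟨insert i₀ J, by rw [card_insert_of_notMem hi₀J, hJcard], ?_, ?_⟩
    · intro i hi h0
      rcases mem_insert.1 hi with rfl | hi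
      · have := hsupp i h0
        rw [this] at hi₀
        have : 0 < 1 / (d : ℝ) := by positivity
        linarith
      · refine hJ0 i hi ?_
        simp only [y'']
        rw [hsupp i h0]
        simp
    · rw [coe_insert]
      refine hJ.insert fun i hi _ => hJdis i hi

end FractionalMatching

/-! ### Rooted forests: climbing to representatives, and subtree sums. -/

/-- A rooted forest, given by the parents of its nodes. -/
structure RootedForest (τ : Type*) where
  parent : τ → Option τ
  depth : τ → ℕ
  depth_lt : ∀ q p, parent q = some p → depth p < depth q

namespace RootedForest

variable {τ : Type*} (F : RootedForest τ)

open Classical in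
/-- The node reached from `q` by following parents as long as the nodes are linked to them. -/
noncomputable def climb (link : τ → Prop) (q : τ) : τ :=
  match _h : F.parent q with
  | none => q
  | some p => if link q then climb link p else q
termination_by F.depth q
decreasing_by exact F.depth_lt q p _h

theorem climb_eq_climb_parent {link : τ → Prop} {q p : τ} (hp : F.parent q = some p)
    (hl : link q) : F.climb link q = F.climb link p := by
  rw [climb]
  split
  · simp_all
  · rename_i p' hp'
    rw [if_pos hl, Option.some.inj (hp.symm.trans hp')]

theorem climb_eq_self {link : τ → Prop} {q : τ}
    (h : ¬ (link q ∧ ∃ p, F.parent q = some p)) : F.climb link q = q := by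
  rw [climb]
  split
  · rfl
  · rename_i p hp
    rw [if_neg fun hl => h ⟨hl, p, hp⟩]

/-- The node reached is a fixed point of climbing, so it can represent the whole piece of nodes that
climb to it. -/
theorem climb_induction {Q : τ → Prop} {link : τ → Prop}
    (hQ : ∀ q p, F.parent q = some p → link q → Q q → Q p) (q : τ) (hq : Q q) :
    Q (F.climb link q) ∧ F.climb link (F.climb link q) = F.climb link q := by
  induction hn : F.depth q using Nat.strong_induction_on generalizing q with
  | _ n ih =>
    subst hn
    by_cases h : link q ∧ ∃ p, F.parent q = some p
    · obtain ⟨hl, p, hp⟩ := h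
      rw [F.climb_eq_climb_parent hp hl]
      exact ih _ (F.depth_lt q p hp) p (hQ q p hp hl hq) rfl
    · have := F.climb_eq_self h
      rw [this]
      exact ⟨hq, this⟩

variable [Fintype τ] [DecidableEq τ]

/-- The children of a node. -/
def children (q : τ) : Finset τ := univ.filter fun c => F.parent c = some q

theorem mem_children {q c : τ} : c ∈ F.children q ↔ F.parent c = some q := by
  simp [children]

/-- The nodes of `D` whose parents are not in `D`. -/
def tops (D : Finset τ) : Finset τ := D.filter fun q => ∀ p ∈ D, F.parent q ≠ some p

theorem tops_nonempty {D : Finset τ} (hD : D.Nonempty) : (F.tops D).Nonempty := by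
  obtain ⟨q, hq, hmin⟩ := D.exists_min_image F.depth hD
  refine ⟨q, mem_filter.2 ⟨hq, fun p hp hqp => ?_⟩⟩
  exact absurd (hmin p hp) (not_le.2 (F.depth_lt q p hqp))

theorem sum_sum_children {M : Type*} [AddCommMonoid M] (f : τ → M) :
    ∑ q, ∑ c ∈ F.children q, f c = ∑ c ∈ univ.filter (fun c => F.parent c ≠ none), f c := by
  simp only [children, sum_filter]
  rw [sum_comm]
  refine sum_congr rfl fun c _ => ?_
  rcases h : F.parent c with _ | p
  · simp
  · simp [sum_ite_eq]

theorem sum_sub_sum_children {M : Type*} [AddCommGroup M] (f : τ → M) :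
    ∑ q, (f q - ∑ c ∈ F.children q, f c) = ∑ q ∈ univ.filter (fun q => F.parent q = none), f q := by
  rw [sum_sub_distrib, sum_sum_children,
    ← sum_filter_add_sum_filter_not univ (fun q => F.parent q = none) f]
  simp

/-- The truncated recursion for the sums over subtrees. -/
def subtreeSumAux (b : τ → ℝ) : ℕ → τ → ℝ
  | 0, _ => 0
  | n + 1, q => b q + ∑ c ∈ F.children q, subtreeSumAux b n c

/-- The recursion truncated past the maximal depth has stabilised, and continuity in `b` is evident
for the truncated sums. -/
theorem exists_subtreeSum : ∃ A : (τ → ℝ) → τ → ℝ,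
    (∀ b q, A b q = b q + ∑ c ∈ F.children q, A b c) ∧ ∀ q, Continuous fun b => A b q := by
  have hM : ∀ q, F.depth q ≤ univ.sup F.depth := fun q => le_sup (mem_univ q)
  have hstab : ∀ n b q, univ.sup F.depth < F.depth q + n →
      F.subtreeSumAux b (n + 1) q = F.subtreeSumAux b n q := by
    intro n b
    induction n with
    | zero =>
      intro q h
      have := hM q
      omega
    | succ n ih =>
      intro q h
      rw [subtreeSumAux, subtreeSumAux]
      congr 1
      refine sum_congr rfl fun c hc => ih c ?_
      have := F.depth_lt c q (F.mem_children.1 hc)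
      omega
  refine ⟨fun b => F.subtreeSumAux b (univ.sup F.depth + 1), fun b q => ?_, fun q => ?_⟩
  · show F.subtreeSumAux b (univ.sup F.depth + 1) q = _
    rw [← hstab _ b q (by omega), subtreeSumAux]
  · show Continuous fun b => F.subtreeSumAux b (univ.sup F.depth + 1) q
    generalize univ.sup F.depth + 1 = n
    induction n generalizing q with
    | zero => exact continuous_const
    | succ n ih =>
      simp only [subtreeSumAux]
      exact (continuous_apply q).add (continuous_finsetSum _ fun c _ => ih c)

end RootedForest

/-! ### Cutting a forest into pieces of mass less than 1, and Berger's theorem. -/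

/-- The largest integer less than `t`. -/
noncomputable def predCeil (t : ℝ) : ℤ := ⌈t⌉ - 1

theorem predCeil_lt (t : ℝ) : (predCeil t : ℝ) < t := by
  have := Int.ceil_lt_add_one t
  simp only [predCeil, Int.cast_sub, Int.cast_one]
  linarith

theorem le_predCeil {m : ℤ} {t : ℝ} (h : (m : ℝ) < t) : m ≤ predCeil t := by
  have := Int.lt_ceil.2 h
  simp only [predCeil]
  omega

/-- Unlike the floor, `predCeil` is lower semicontinuous, since `predCeil t < t` is strict and
persists nearby. This is why `NodeUncut` and `EdgeUncut` use it: they become open conditions on the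
weights. -/
theorem isOpen_lt_sum_predCeil {X κ : Type*} [TopologicalSpace X] (s : Finset κ) {f : X → ℝ}
    {g : κ → X → ℝ} (hf : Continuous f) (hg : ∀ k, Continuous (g k)) :
    IsOpen {x | f x < ((∑ k ∈ s, predCeil (g k x) : ℤ) : ℝ) + 1} := by
  rw [isOpen_iff_eventually]
  intro x hx
  have h1 : ∀ᶠ y in nhds x, f y < ((∑ k ∈ s, predCeil (g k x) : ℤ) : ℝ) + 1 :=
    hf.continuousAt.eventually_lt continuousAt_const hx
  have h2 : ∀ᶠ y in nhds x, ∀ k ∈ s, (predCeil (g k x) : ℝ) < g k y := by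
    rw [Filter.eventually_all_finset]
    intro k _
    exact continuousAt_const.eventually_lt (hg k).continuousAt (predCeil_lt _)
  filter_upwards [h1, h2] with y hy1 hy2
  have : (∑ k ∈ s, predCeil (g k x) : ℤ) ≤ ∑ k ∈ s, predCeil (g k y) :=
    sum_le_sum fun k hk => le_predCeil (hy2 k hk)
  have : ((∑ k ∈ s, predCeil (g k x) : ℤ) : ℝ) ≤ ((∑ k ∈ s, predCeil (g k y) : ℤ) : ℝ) := by
    exact_mod_cast this
  show f y < _
  linarith

namespace RootedForest

variable {τ : Type*} (F : RootedForest τ) [Fintype τ] [DecidableEq τ]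

/-- `A` accumulates, from the leaves upwards, the masses `m` and a mass `ε` for every node and
every edge. -/
def IsAccumulation (ε : ℝ) (m A : τ → ℝ) : Prop :=
  ∀ q, A q = m q + ε * ((F.children q).card + 1) + ∑ c ∈ F.children q, A c

/-- No multiple of the threshold `1` is passed within the node `q`. -/
def NodeUncut (ε : ℝ) (A : τ → ℝ) (q : τ) : Prop :=
  A q < ((∑ c ∈ F.children q, predCeil (A c + ε) : ℤ) : ℝ) + 1

/-- No multiple of the threshold `1` is passed within the edge above the node `c`. -/
def EdgeUncut (ε : ℝ) (A : τ → ℝ) (c : τ) : Prop :=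
  A c + ε < (predCeil (A c) : ℝ) + 1

/-- The nodes at which the accumulated mass passes a multiple of the threshold `1`. -/
noncomputable def cut (A : τ → ℝ) : Finset τ :=
  univ.filter fun q => ∑ c ∈ F.children q, ⌊A c⌋ < ⌊A q⌋

variable {F} {ε : ℝ} {m A : τ → ℝ}

theorem IsAccumulation.sum_add_le (hA : F.IsAccumulation ε m A) (hm : ∀ q, 0 ≤ m q)
    (q : τ) : ∑ c ∈ F.children q, (A c + ε) + ε ≤ A q := by
  rw [hA q, sum_add_distrib, sum_const, nsmul_eq_mul]
  linarith [hm q]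

theorem IsAccumulation.sum_floor_le (hA : F.IsAccumulation ε m A) (hε : 0 < ε)
    (hm : ∀ q, 0 ≤ m q) (q : τ) : ∑ c ∈ F.children q, ⌊A c + ε⌋ ≤ ⌊A q⌋ := by
  rw [Int.le_floor, Int.cast_sum]
  have h1 : ∑ c ∈ F.children q, ((⌊A c + ε⌋ : ℤ) : ℝ) ≤ ∑ c ∈ F.children q, (A c + ε) :=
    sum_le_sum fun c _ => Int.floor_le _
  linarith [hA.sum_add_le hm q]

/-- Each cut accounts for at least 1 in the sum of the increments of `⌊A q⌋`, which telescopes to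
the floors at the roots, hence to at most the whole mass. Nodes and edges together contribute at
most `2 * ε * |τ|`. -/
theorem IsAccumulation.card_cut_le (hA : F.IsAccumulation ε m A) (hε : 0 < ε)
    (hm : ∀ q, 0 ≤ m q) {n : ℕ} (hn : ∑ q, m q + 2 * ε * Fintype.card τ < n + 1) :
    (F.cut A).card ≤ n := by
  have hmono : ∀ q, ∑ c ∈ F.children q, ⌊A c⌋ ≤ ⌊A q⌋ := fun q =>
    (sum_le_sum fun c _ => Int.floor_le_floor (by linarith)).trans (hA.sum_floor_le hε hm q)
  have h1 : ((F.cut A).card : ℤ) ≤ ∑ q, (⌊A q⌋ - ∑ c ∈ F.children q, ⌊A c⌋) := by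
    rw [cut, card_filter, Nat.cast_sum]
    refine sum_le_sum fun q _ => ?_
    have := hmono q
    split_ifs with h
    · push_cast; omega
    · push_cast; omega
  rw [sum_sub_sum_children] at h1
  have h2 : ((∑ q ∈ univ.filter (fun q => F.parent q = none), ⌊A q⌋ : ℤ) : ℝ) ≤
      ∑ q ∈ univ.filter (fun q => F.parent q = none), A q := by
    rw [Int.cast_sum]
    exact sum_le_sum fun q _ => Int.floor_le _
  rw [← F.sum_sub_sum_children A] at h2
  have h3 : ∑ q, (A q - ∑ c ∈ F.children q, A c) ≤ ∑ q, m q + 2 * ε * Fintype.card τ := by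
    have h4 : ∑ q, (((F.children q).card : ℝ) + 1) ≤ 2 * Fintype.card τ := by
      have h5 : ∑ q, ((F.children q).card : ℝ) ≤ Fintype.card τ := by
        have := F.sum_sum_children (fun _ => (1 : ℝ))
        simp only [sum_const, nsmul_eq_mul, mul_one] at this
        rw [this]
        exact_mod_cast card_le_univ _
      rw [sum_add_distrib, sum_const, nsmul_eq_mul, mul_one, card_univ]
      linarith
    have h6 : ∑ q, (A q - ∑ c ∈ F.children q, A c) =
        ∑ q, m q + ε * ∑ q, (((F.children q).card : ℝ) + 1) := by
      rw [mul_sum, ← sum_add_distrib]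
      refine sum_congr rfl fun q _ => ?_
      rw [hA q]
      ring
    rw [h6]
    nlinarith [mul_le_mul_of_nonneg_left h4 hε.le]
  have h7 : (((F.cut A).card : ℤ) : ℝ) < n + 1 := by
    have : (((F.cut A).card : ℤ) : ℝ) ≤
        ((∑ q ∈ univ.filter (fun q => F.parent q = none), ⌊A q⌋ : ℤ) : ℝ) := by exact_mod_cast h1
    linarith
  have : (F.cut A).card < n + 1 := by exact_mod_cast h7
  omega

/-- The mass `ε` of the edge above `c` puts `⌊A c⌋` strictly below `A c + ε`, so passing from floors
to `predCeil` loses nothing. -/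
theorem nodeUncut_of_notMem_cut (hε : 0 < ε) {q : τ} (hq : q ∉ F.cut A) :
    F.NodeUncut ε A q := by
  simp only [cut, mem_filter, mem_univ, true_and, not_lt] at hq
  have h1 : ∑ c ∈ F.children q, ⌊A c⌋ ≤ ∑ c ∈ F.children q, predCeil (A c + ε) :=
    sum_le_sum fun c _ => le_predCeil (by linarith [Int.floor_le (A c)])
  have h2 : ((⌊A q⌋ : ℤ) : ℝ) ≤ ((∑ c ∈ F.children q, predCeil (A c + ε) : ℤ) : ℝ) := by
    exact_mod_cast hq.trans h1
  rw [NodeUncut]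
  linarith [Int.lt_floor_add_one (A q)]

/-- An integer reached along the edge would raise the floor and force `q` into the cut. At the lower
end, `A c` is not an integer, because `c` is not cut and carries its own mass `ε`. -/
theorem IsAccumulation.edgeUncut (hA : F.IsAccumulation ε m A) (hε : 0 < ε)
    (hm : ∀ q, 0 ≤ m q) {q c : τ} (hc : F.parent c = some q) (hqcut : q ∉ F.cut A)
    (hccut : c ∉ F.cut A) : EdgeUncut ε A c := by
  simp only [cut, mem_filter, mem_univ, true_and, not_lt] at hqcut hccut
  have h1 : ⌊A c + ε⌋ ≤ ⌊A c⌋ := by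
    by_contra hcon
    have : ∑ c ∈ F.children q, ⌊A c⌋ < ∑ c ∈ F.children q, ⌊A c + ε⌋ :=
      sum_lt_sum (fun c _ => Int.floor_le_floor (by linarith))
        ⟨c, F.mem_children.2 hc, not_le.1 hcon⟩
    have := hA.sum_floor_le hε hm q
    omega
  have h2 : ((⌊A c⌋ : ℤ) : ℝ) < A c := by
    have h3 : ((⌊A c⌋ : ℤ) : ℝ) ≤ ((∑ c ∈ F.children c, ⌊A c⌋ : ℤ) : ℝ) := by exact_mod_cast hccut
    rw [Int.cast_sum] at h3
    have h4 : ∑ c ∈ F.children c, ((⌊A c⌋ : ℤ) : ℝ) ≤ ∑ c ∈ F.children c, (A c + ε) :=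
      sum_le_sum fun c _ => by linarith [Int.floor_le (A c)]
    linarith [hA.sum_add_le hm c]
  have h5 : ((⌊A c + ε⌋ : ℤ) : ℝ) ≤ (predCeil (A c) : ℝ) := by
    exact_mod_cast h1.trans (le_predCeil h2)
  rw [EdgeUncut]
  linarith [Int.lt_floor_add_one (A c + ε)]

/-- The mass of a set of nodes connected to `r` without cuts is less than the threshold. -/
theorem IsAccumulation.sum_lt_one (hA : F.IsAccumulation ε m A) (hε : 0 < ε)
    {K : Finset τ} {r : τ} (hr : r ∈ K)
    (hK : ∀ q ∈ K, F.NodeUncut ε A q)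
    (hlink : ∀ c ∈ K, c ≠ r → ∃ q ∈ K, F.parent c = some q ∧ EdgeUncut ε A c) :
    ∑ q ∈ K, m q < 1 := by
  -- `g c` and `f c` are the residues of the mass at `c` and at the upper end of the edge above it.
  -- Uncut nodes give `m q ≤ g q - ∑ f c`, uncut edges give `g c ≤ f c`, and the sum over `K`
  -- telescopes to at most `g r < 1`.
  let f : τ → ℝ := fun c => A c + ε - predCeil (A c + ε)
  let g : τ → ℝ := fun c => A c - ⌊A c⌋
  have hf : ∀ c, 0 ≤ f c := fun c => by
    have := predCeil_lt (A c + ε)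
    simp only [f]
    linarith
  have h1 : ∑ q ∈ K, m q ≤ ∑ q ∈ K, (g q - ∑ c ∈ F.children q, f c) := by
    refine sum_le_sum fun q hq => ?_
    have h2 : ⌊A q⌋ ≤ ∑ c ∈ F.children q, predCeil (A c + ε) := by
      have := hK q hq
      rw [NodeUncut] at this
      have : ((⌊A q⌋ : ℤ) : ℝ) < ((∑ c ∈ F.children q, predCeil (A c + ε) + 1 : ℤ) : ℝ) := by
        push_cast at this ⊢
        linarith [Int.floor_le (A q)]
      have : ⌊A q⌋ < ∑ c ∈ F.children q, predCeil (A c + ε) + 1 := by exact_mod_cast this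
      omega
    have h2' : ((⌊A q⌋ : ℤ) : ℝ) ≤ ∑ c ∈ F.children q, (predCeil (A c + ε) : ℝ) := by
      rw [← Int.cast_sum]
      exact_mod_cast h2
    have h3 := hA q
    simp only [f, g, sum_sub_distrib, sum_add_distrib, sum_const, nsmul_eq_mul]
    linarith
  have h4 : ∑ c ∈ K.erase r, g c ≤ ∑ q ∈ K, ∑ c ∈ F.children q, f c := by
    simp only [children, sum_filter]
    rw [sum_comm]
    calc ∑ c ∈ K.erase r, g c
        ≤ ∑ c ∈ K.erase r, ∑ q ∈ K, (if F.parent c = some q then f c else 0) := by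
          refine sum_le_sum fun c hc => ?_
          obtain ⟨hcr, hcK⟩ := mem_erase.1 hc
          obtain ⟨q, hq, hcq, hedge⟩ := hlink c hcK hcr
          have h5 : g c ≤ f c := by
            rw [EdgeUncut] at hedge
            have h6 := predCeil_lt (A c + ε)
            have h7 : predCeil (A c + ε) < predCeil (A c) + 1 := by
              have : (predCeil (A c + ε) : ℝ) < ((predCeil (A c) + 1 : ℤ) : ℝ) := by
                push_cast
                linarith
              exact_mod_cast this
            have h8 : predCeil (A c) ≤ ⌊A c⌋ := Int.le_floor.2 (predCeil_lt _).le
            have h9 : (predCeil (A c + ε) : ℝ) ≤ ((⌊A c⌋ : ℤ) : ℝ) := by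
              have : predCeil (A c + ε) ≤ ⌊A c⌋ := by omega
              exact_mod_cast this
            simp only [f, g]
            linarith
          refine h5.trans ?_
          rw [hcq]
          simp [hq]
      _ ≤ _ := by
          refine sum_le_sum_of_subset_of_nonneg (subset_univ _) fun c _ _ => ?_
          refine sum_nonneg fun q _ => ?_
          split_ifs
          · exact hf c
          · exact le_rfl
  rw [sum_sub_distrib, ← add_sum_erase K g hr] at h1
  have h10 : g r < 1 := by
    have := Int.lt_floor_add_one (A r)
    simp only [g]
    linarith
  linarith

/-- **Berger's theorem** on families of subforests with at most `d` components. -/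
theorem exists_pairwiseDisjoint_of_forall_exists_disjoint (F : RootedForest τ) {I : Type*}
    [Fintype I] {d : ℕ} (hd : 1 ≤ d) (j : ℕ) (D : I → Finset τ) (hne : ∀ i, (D i).Nonempty)
    (htops : ∀ i, (F.tops (D i)).card ≤ d)
    (hcov : ∀ C : Finset τ, C.card ≤ (d ^ 2 - d + 1) * j → ∃ i, Disjoint C (D i)) :
    ∃ J : Finset I, J.card = j + 1 ∧ (J : Set I).PairwiseDisjoint D := by
  classical
  have hI : Nonempty I := ⟨(hcov ∅ (by simp)).choose⟩
  set n : ℕ := (d ^ 2 - d + 1) * j with hn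
  have hd1 : (1 : ℝ) ≤ d := by exact_mod_cast hd
  have hd0 : (0 : ℝ) < d := by linarith
  -- The total mass is at most `d * lam = n + 1 / 2`, which with at most `1 / 4` from `ε` stays
  -- below `n + 1` and allows only `n` cuts. At the same time `lam > n / d`, the strict inequality
  -- needed for Füredi's theorem.
  let lam : ℝ := ((n : ℝ) + 1 / 2) / d
  have hlam : 0 < lam := by positivity
  let ε : ℝ := 1 / (8 * ((Fintype.card τ : ℝ) + 1))
  have hε : 0 < ε := by positivity
  have hετ : 2 * ε * Fintype.card τ ≤ 1 / 4 := by
    simp only [ε]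
    rw [mul_one_div, div_mul_eq_mul_div, div_le_iff₀ (by positivity)]
    linarith
  let T : I → Finset τ := fun i => F.tops (D i)
  let m : (I → ℝ) → τ → ℝ := fun w q => lam * load T w q
  obtain ⟨A₀, hA₀, hA₀c⟩ := F.exists_subtreeSum
  let A : (I → ℝ) → τ → ℝ := fun w => A₀ fun q => m w q + ε * ((F.children q).card + 1)
  have hA : ∀ w, F.IsAccumulation ε (m w) (A w) := fun w q => hA₀ _ q
  have hmc : ∀ q, Continuous fun w => m w q := by
    intro q
    refine continuous_const.mul (continuous_finsetSum _ fun i _ => ?_)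
    split_ifs
    · exact continuous_apply i
    · exact continuous_const
  have hAc : ∀ q, Continuous fun w => A w q := fun q =>
    (hA₀c q).comp (continuous_pi fun q => (hmc q).add continuous_const)
  have hm : ∀ w ∈ stdSimplex ℝ I, ∀ q, 0 ≤ m w q := by
    intro w hw q
    refine mul_nonneg hlam.le (sum_nonneg fun i _ => ?_)
    split_ifs
    · exact hw.1 i
    · exact le_rfl
  let U : I → Set (I → ℝ) := fun i => {w | ∀ q ∈ D i, F.NodeUncut ε (A w) q ∧
    ∀ c ∈ D i, F.parent c = some q → EdgeUncut ε (A w) c}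
  have hU : ∀ i, IsOpen (U i) := by
    intro i
    have : U i = ⋂ q ∈ D i, ({w | F.NodeUncut ε (A w) q} ∩
        ⋂ c ∈ (D i).filter (fun c => F.parent c = some q), {w | EdgeUncut ε (A w) c}) := by
      ext w
      simp [U]
    rw [this]
    refine isOpen_biInter_finset fun q _ => IsOpen.inter ?_ (isOpen_biInter_finset fun c _ => ?_)
    · exact isOpen_lt_sum_predCeil (F.children q) (hAc q) fun c => (hAc c).add continuous_const
    · have := isOpen_lt_sum_predCeil {c} ((hAc c).add (continuous_const (y := ε))) hAc
      simp only [sum_singleton] at this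
      exact this
  have hcover : stdSimplex ℝ I ⊆ ⋃ i, U i := by
    intro w hw
    have hmass : ∑ q, m w q ≤ n + 1 / 2 := by
      simp only [m]
      rw [← mul_sum, sum_load]
      have h1 : ∑ i, ((univ ∩ T i).card : ℝ) * w i ≤ ∑ i, (d : ℝ) * w i := by
        refine sum_le_sum fun i _ => mul_le_mul_of_nonneg_right ?_ (hw.1 i)
        rw [univ_inter]
        exact_mod_cast htops i
      rw [← mul_sum, hw.2, mul_one] at h1
      calc lam * ∑ i, ((univ ∩ T i).card : ℝ) * w i ≤ lam * d :=
            mul_le_mul_of_nonneg_left h1 hlam.le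
        _ = _ := div_mul_cancel₀ _ hd0.ne'
    have hcut := (hA w).card_cut_le hε (hm w hw) (n := n) (by linarith)
    obtain ⟨i, hi⟩ := hcov _ hcut
    rw [disjoint_right] at hi
    refine Set.mem_iUnion.2 ⟨i, fun q hq => ⟨nodeUncut_of_notMem_cut hε (hi hq), ?_⟩⟩
    exact fun c hc hcq => (hA w).edgeUncut hε (hm w hw) hcq (hi hq) (hi hc)
  obtain ⟨w, hw, hwU⟩ := exists_mem_of_support_of_isOpen_cover U hU hcover
  -- Asking that the parent be uncut makes this an invariant of climbing, so the representative of a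
  -- piece is uncut as well.
  let link : τ → Prop := fun c => F.NodeUncut ε (A w) c ∧ EdgeUncut ε (A w) c ∧
    ∀ q, F.parent c = some q → F.NodeUncut ε (A w) q
  let ρ : τ → τ := F.climb link
  have hρ : ∀ q p, F.parent q = some p → link q → ρ q = ρ p := fun q p =>
    F.climb_eq_climb_parent
  let S : I → Finset τ := fun i => (T i).image ρ
  have hS : ∀ i, (S i).Nonempty := fun i => (F.tops_nonempty (hne i)).image ρ
  have hScard : ∀ i, (S i).card ≤ d := fun i => card_image_le.trans (htops i)
  have hmatch : IsFractionalMatching S fun i => lam * w i := by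
    refine ⟨fun i => mul_nonneg hlam.le (hw.1 i), fun r => ?_⟩
    by_cases hr : ∃ i, w i ≠ 0 ∧ r ∈ S i
    · obtain ⟨i₀, hi₀, hri₀⟩ := hr
      obtain ⟨t, ht, htr⟩ := mem_image.1 hri₀
      have htD : t ∈ D i₀ := (mem_filter.1 ht).1
      obtain ⟨hr1, hr2⟩ := F.climb_induction (Q := F.NodeUncut ε (A w))
        (link := link) (fun q p hp hl _ => hl.2.2 p hp) t (hwU i₀ hi₀ t htD).1
      change F.climb link t = r at htr
      rw [htr] at hr1 hr2
      let K : Finset τ := univ.filter fun q => ρ q = r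
      have hKr : r ∈ K := by simpa [K] using hr2
      have hKlink : ∀ c ∈ K, c ≠ r → link c ∧ ∃ p, F.parent c = some p := by
        intro c hc hcr
        by_contra hcon
        have h1 := F.climb_eq_self hcon
        have h2 : ρ c = r := (mem_filter.1 hc).2
        exact hcr (h1.symm.trans h2)
      have hlt := (hA w).sum_lt_one hε hKr
        (fun q hq => by
          by_cases hqr : q = r
          · rw [hqr]; exact hr1
          · exact (hKlink q hq hqr).1.1)
        (fun c hc hcr => by
          obtain ⟨hl, p, hp⟩ := hKlink c hc hcr
          refine ⟨p, ?_, hp, hl.2.1⟩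
          have h2 : ρ c = r := (mem_filter.1 hc).2
          simp only [K, mem_filter, mem_univ, true_and]
          rw [← h2, hρ c p hp hl])
      refine le_trans ?_ hlt.le
      simp only [m]
      rw [← mul_sum, sum_load, mul_sum, load]
      refine sum_le_sum fun i _ => ?_
      split_ifs with hri
      · obtain ⟨t, ht, htr⟩ := mem_image.1 hri
        have h1 : 1 ≤ (K ∩ T i).card := card_pos.2 ⟨t, mem_inter.2 ⟨by simpa [K] using htr, ht⟩⟩
        have h2 : (1 : ℝ) ≤ (K ∩ T i).card := by exact_mod_cast h1
        have h3 := mul_le_mul_of_nonneg_right h2 (hw.1 i)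
        rw [one_mul] at h3
        exact mul_le_mul_of_nonneg_left h3 hlam.le
      · exact mul_nonneg hlam.le (mul_nonneg (Nat.cast_nonneg _) (hw.1 i))
    · push Not at hr
      have : load S (fun i => lam * w i) r = 0 := by
        refine sum_eq_zero fun i _ => ?_
        split_ifs with hri
        · by_contra hcon
          exact hr i (fun h => hcon (by simp [h])) hri
        · rfl
      rw [this]
      exact zero_le_one
  have htotal : ((d : ℝ) - 1 + 1 / d) * j < ∑ i, lam * w i := by
    rw [← mul_sum, hw.2, mul_one, lt_div_iff₀ hd0]
    have hle : d ≤ d ^ 2 := by nlinarith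
    rw [hn]
    push_cast [Nat.cast_sub hle]
    have : ((d : ℝ) - 1 + 1 / d) * j * d = ((d : ℝ) ^ 2 - d + 1) * j := by
      field_simp
    rw [this]
    linarith
  obtain ⟨J, hJcard, hJ0, hJ⟩ := hmatch.exists_pairwiseDisjoint hS hd hScard j htotal
  refine ⟨J, hJcard, fun i hi i' hi' hii' => ?_⟩
  -- Inside a member of positive weight every node is linked to its parent in the member, so it has
  -- the same representative as one of the tops. A node common to two members would put its
  -- representative into both sets `S i`.
  have hmem : ∀ i ∈ J, ∀ k q, F.depth q = k → q ∈ D i → ρ q ∈ S i := by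
    intro i hi k
    have hwi : w i ≠ 0 := fun h => hJ0 i hi (by simp [h])
    induction k using Nat.strong_induction_on with
    | _ k ih =>
      intro q hqk hq
      by_cases hqt : q ∈ T i
      · exact mem_image_of_mem _ hqt
      · have : ∃ p ∈ D i, F.parent q = some p := by
          by_contra hcon
          push Not at hcon
          exact hqt (mem_filter.2 ⟨hq, hcon⟩)
        obtain ⟨p, hp, hqp⟩ := this
        have hwu := hwU i hwi
        have hl : link q := ⟨(hwu q hq).1, (hwu p hp).2 q hq hqp, fun p' hp' => by
          rw [hqp] at hp'
          rw [← Option.some.inj hp']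
          exact (hwu p hp).1⟩
        rw [hρ q p hqp hl]
        exact ih _ (hqk ▸ F.depth_lt q p hqp) p rfl hp
  show Disjoint (D i) (D i')
  rw [disjoint_left]
  intro q hq hq'
  exact disjoint_left.1 (hJ hi hi' hii') (hmem i hi _ q rfl hq) (hmem i' hi' _ q rfl hq')

end RootedForest

/-! ### Trees as rooted forests. -/

section Tree

variable {τ : Type*} {T : SimpleGraph τ}

theorem IsTree.eq_choose_existsUnique_path (hT : T.IsTree) {q r : τ} {p : T.Walk q r}
    (hp : p.IsPath) : p = (hT.existsUnique_path q r).choose :=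
  (hT.existsUnique_path q r).choose_spec.2 p hp

open Classical in
/-- A tree with a root `r` as a rooted forest. -/
noncomputable def rootedForest (hT : T.IsTree) (r : τ) : RootedForest τ where
  parent q := if q = r then none else some (hT.existsUnique_path q r).choose.snd
  depth q := (hT.existsUnique_path q r).choose.length
  depth_lt q p h := by
    split_ifs at h with hq
    rw [← Option.some.inj h]
    set w := (hT.existsUnique_path q r).choose with hw
    have hwp : w.IsPath := (hT.existsUnique_path q r).choose_spec.1
    have hnil : ¬ w.Nil := SimpleGraph.Walk.not_nil_of_ne hq
    rw [← IsTree.eq_choose_existsUnique_path hT hwp.tail,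
      ← SimpleGraph.Walk.length_tail_add_one hnil]
    exact Nat.lt_succ_self _

theorem rootedForest_parent_of_adj (hT : T.IsTree) (r : τ) {q q' : τ} (h : T.Adj q q') :
    (rootedForest hT r).parent q = some q' ∨ (rootedForest hT r).parent q' = some q := by
  classical
  set w := (hT.existsUnique_path q r).choose with hw
  have hwp : w.IsPath := (hT.existsUnique_path q r).choose_spec.1
  by_cases hq' : q' ∈ w.support
  · left
    have hqr : q ≠ r := by
      rintro rfl
      have hnil : w = SimpleGraph.Walk.nil := by
        rw [hw]
        exact (IsTree.eq_choose_existsUnique_path hT SimpleGraph.Walk.IsPath.nil).symm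
      rw [hnil] at hq'
      simp only [SimpleGraph.Walk.support_nil, List.mem_singleton] at hq'
      exact h.ne hq'.symm
    simp only [rootedForest, if_neg hqr]
    rw [← hw, hT.isAcyclic.eq_snd_of_adj_start hwp h hq']
  · right
    have hqr : q' ≠ r := by
      rintro rfl
      exact hq' w.end_mem_support
    have hcons : (SimpleGraph.Walk.cons h.symm w).IsPath :=
      (SimpleGraph.Walk.cons_isPath_iff _ _).2 ⟨hwp, hq'⟩
    simp only [rootedForest, if_neg hqr]
    rw [← IsTree.eq_choose_existsUnique_path hT hcons, SimpleGraph.Walk.snd_cons]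

/-- Climbing within `D` gives the same result at both ends of every tree edge in `D`, hence is
constant on `D`, yet it fixes every top. -/
theorem card_tops_le_one [Fintype τ] [DecidableEq τ] (hT : T.IsTree) (r : τ) {D : Finset τ}
    (hD : ∀ q ∈ D, ∀ q' ∈ D, Relation.ReflTransGen (fun a b => T.Adj a b ∧ a ∈ D ∧ b ∈ D) q q') :
    ((rootedForest hT r).tops D).card ≤ 1 := by
  set F := rootedForest hT r
  let link : τ → Prop := fun c => c ∈ D ∧ ∃ p ∈ D, F.parent c = some p
  have hadj : ∀ a b, T.Adj a b ∧ a ∈ D ∧ b ∈ D → F.climb link a = F.climb link b := by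
    rintro a b ⟨hab, ha, hb⟩
    rcases rootedForest_parent_of_adj hT r hab with h | h
    · exact F.climb_eq_climb_parent h ⟨ha, b, hb, h⟩
    · exact (F.climb_eq_climb_parent h ⟨hb, a, ha, h⟩).symm
  have hconst : ∀ q ∈ D, ∀ q' ∈ D, F.climb link q = F.climb link q' := by
    intro q hq q' hq'
    induction hD q hq q' hq' with
    | refl => rfl
    | tail _ h ih => exact (ih h.2.1).trans (hadj _ _ h)
  rw [card_le_one]
  have htop : ∀ t ∈ F.tops D, t ∈ D ∧ F.climb link t = t := by
    intro t ht
    obtain ⟨htD, ht⟩ := mem_filter.1 ht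
    refine ⟨htD, F.climb_eq_self ?_⟩
    rintro ⟨⟨-, p, hp, htp⟩, -⟩
    exact ht p hp htp
  intro t ht t' ht'
  rw [← (htop t ht).2, ← (htop t' ht').2]
  exact hconst t (htop t ht).1 t' (htop t' ht').1

end Tree

/-! ### From tree-decompositions to the Erdős–Pósa property. -/

section TreeDecomposition

variable {V τ : Type*} {G : SimpleGraph V} {T : SimpleGraph τ} [Fintype τ]

open Classical in
/-- The nodes of the tree whose bags meet `X`. -/
noncomputable def TreeDecomposition.nodes (D : TreeDecomposition G T) (X : Set V) : Finset τ :=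
  univ.filter fun t => ∃ a ∈ X, a ∈ D.bag t

theorem TreeDecomposition.mem_nodes (D : TreeDecomposition G T) {X : Set V} {t : τ} :
    t ∈ D.nodes X ↔ ∃ a ∈ X, a ∈ D.bag t := by
  simp [TreeDecomposition.nodes]

/-- The nodes whose bags contain a given vertex are closed under tree paths, and adjacent vertices
share a bag; a walk in `X` chains these subtrees together. -/
theorem TreeDecomposition.reflTransGen_nodes (D : TreeDecomposition G T) {X : G.Subgraph}
    (hX : X.Connected) :
    ∀ t ∈ D.nodes X.verts, ∀ t' ∈ D.nodes X.verts, Relation.ReflTransGen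
      (fun a b => T.Adj a b ∧ a ∈ D.nodes X.verts ∧ b ∈ D.nodes X.verts) t t' := by
  set R := Relation.ReflTransGen
    (fun a b => T.Adj a b ∧ a ∈ D.nodes X.verts ∧ b ∈ D.nodes X.verts)
  have hwalk : ∀ t t' (p : T.Walk t t'), (∀ s ∈ p.support, s ∈ D.nodes X.verts) → R t t' := by
    intro t t' p
    induction p with
    | nil => exact fun _ => Relation.ReflTransGen.refl
    | cons h p ih =>
      intro hp
      refine Relation.ReflTransGen.head ⟨h, hp _ (by simp), hp _ (by simp)⟩
        (ih fun s hs => hp s (by simp [hs]))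
  have hvert : ∀ a ∈ X.verts, ∀ t t', a ∈ D.bag t → a ∈ D.bag t' → R t t' := by
    intro a ha t t' ht ht'
    obtain ⟨p, hp, -⟩ := D.isTree.existsUnique_path t t'
    exact hwalk t t' p fun s hs => D.mem_nodes.2 ⟨a, ha, D.path_mem t s t' p hp hs a ht ht'⟩
  have hreach : ∀ (a b : X.verts) (_ : X.coe.Walk a b), ∀ t t', a.1 ∈ D.bag t → b.1 ∈ D.bag t' →
      R t t' := by
    intro a b p
    induction p with
    | nil => exact fun t t' ht ht' => hvert _ (Subtype.property _) t t' ht ht'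
    | cons h p ih =>
      intro t t' ht ht'
      obtain ⟨s, hs1, hs2⟩ := D.edge_mem _ _ (X.coe_adj_sub _ _ h)
      exact (hvert _ (Subtype.property _) t s ht hs1).trans (ih s t' hs2 ht')
  intro t ht t' ht'
  obtain ⟨a, ha, hat⟩ := D.mem_nodes.1 ht
  obtain ⟨b, hb, hbt⟩ := D.mem_nodes.1 ht'
  obtain ⟨p⟩ := hX.coe.preconnected ⟨a, ha⟩ ⟨b, hb⟩
  exact hreach _ _ p t t' hat hbt

/-- A top of the union is a top of each part containing it, and each connected part has at most one.
-/
theorem TreeDecomposition.card_tops_nodes_le [DecidableEq τ] (D : TreeDecomposition G T) (r : τ)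
    (B : Finset G.Subgraph) (hB : ∀ X ∈ B, X.Connected) :
    ((rootedForest D.isTree r).tops (D.nodes (⋃ X ∈ B, X.verts))).card ≤ B.card := by
  classical
  set F := rootedForest D.isTree r
  have hsub : F.tops (D.nodes (⋃ X ∈ B, X.verts)) ⊆ B.biUnion fun X => F.tops (D.nodes X.verts) := by
    intro t ht
    obtain ⟨htD, ht⟩ := mem_filter.1 ht
    obtain ⟨a, ha, hat⟩ := D.mem_nodes.1 htD
    obtain ⟨X, hX, haX⟩ := Set.mem_iUnion₂.1 ha
    refine mem_biUnion.2 ⟨X, hX, mem_filter.2 ⟨D.mem_nodes.2 ⟨a, haX, hat⟩, fun p hp => ht p ?_⟩⟩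
    obtain ⟨b, hb, hbp⟩ := D.mem_nodes.1 hp
    exact D.mem_nodes.2 ⟨b, Set.mem_iUnion₂.2 ⟨X, hX, hb⟩, hbp⟩
  refine (card_le_card hsub).trans (card_biUnion_le.trans ?_)
  refine (sum_le_sum fun X hX => ?_).trans (card_eq_sum_ones B).ge
  exact card_tops_le_one D.isTree r (D.reflTransGen_nodes (hB X hX))

theorem TreeDecomposition.card_bag_le (D : TreeDecomposition G T) {w : ℕ} (hD : D.width ≤ w)
    (t : τ) : (D.bag t).card ≤ w + 1 := by
  have h1 : (D.bag t).card ≤ univ.sup fun t => (D.bag t).card :=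
    le_sup (f := fun t => (D.bag t).card) (mem_univ t)
  rw [TreeDecomposition.width] at hD
  omega

/-- The Erdős–Pósa property of subgraphs that are covered by at most `h` connected subgraphs. -/
theorem TreeDecomposition.hasDisjoint_or_exists_isDeletionSet (D : TreeDecomposition G T)
    {w h k : ℕ} (hD : D.width ≤ w) (hh : 0 < h) (hk : 0 < k) (P : G.Subgraph → Prop)
    (hP : ∀ F, P F → ∃ B : Finset G.Subgraph, B.Nonempty ∧ B.card ≤ h ∧
      (∀ X ∈ B, X.Connected) ∧ F.verts = ⋃ X ∈ B, X.verts) :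
    HasDisjoint P k ∨ ∃ S : Finset V, IsDeletionSet P S ∧
      S.card ≤ (w + 1) * (h ^ 2 - h + 1) * (k - 1) := by
  classical
  obtain ⟨r⟩ : Nonempty τ := D.isTree.connected.nonempty
  -- Indexing by node sets instead of subgraphs keeps the family finite even when `V` is not.
  let I := {N : Finset τ // ∃ F, P F ∧ D.nodes F.verts = N}
  by_cases hcov : ∀ C : Finset τ, C.card ≤ (h ^ 2 - h + 1) * (k - 1) → ∃ i : I, Disjoint C i.1
  · left
    obtain ⟨J, hJ, hdis⟩ :=
      (rootedForest D.isTree r).exists_pairwiseDisjoint_of_forall_exists_disjoint hh (k - 1)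
        (fun i : I => i.1)
        (by
          rintro ⟨_, F, hF, rfl⟩
          obtain ⟨B, ⟨X, hX⟩, -, hB, hFB⟩ := hP F hF
          obtain ⟨a, ha⟩ := (hB X hX).nonempty
          obtain ⟨t, ht⟩ := D.cover a
          exact ⟨t, D.mem_nodes.2 ⟨a, by rw [hFB]; exact Set.mem_iUnion₂.2 ⟨X, hX, ha⟩, ht⟩⟩)
        (by
          rintro ⟨_, F, hF, rfl⟩
          obtain ⟨B, -, hcard, hB, hFB⟩ := hP F hF
          simp only [hFB]
          exact (D.card_tops_nodes_le r B hB).trans hcard)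
        hcov
    have hJk : Fintype.card J = k := by
      rw [Fintype.card_coe, hJ]
      omega
    choose F hF hFN using fun i : I => i.2
    let e : Fin k ≃ J := (Fintype.equivFinOfCardEq hJk).symm
    refine ⟨fun i => F (e i).1, fun i => hF _, fun i i' hii' => ?_⟩
    have hne : (e i).1 ≠ (e i').1 := fun h => hii' (e.injective (Subtype.ext h))
    have hd := disjoint_left.1 (hdis (e i).2 (e i').2 hne)
    rw [Set.disjoint_left]
    intro a ha ha'
    obtain ⟨t, ht⟩ := D.cover a
    exact hd ((hFN (e i).1).subset (D.mem_nodes.2 ⟨a, ha, ht⟩))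
      ((hFN (e i').1).subset (D.mem_nodes.2 ⟨a, ha', ht⟩))
  · right
    push Not at hcov
    obtain ⟨C, hC, hhit⟩ := hcov
    refine ⟨C.biUnion D.bag, fun F hF hPF => ?_, ?_⟩
    · obtain ⟨t, htC, htF⟩ := not_disjoint_iff.1 (hhit ⟨_, F, hPF, rfl⟩)
      obtain ⟨a, ha, hat⟩ := D.mem_nodes.1 htF
      have := (SimpleGraph.Subgraph.verts_mono hF) ha
      rw [SimpleGraph.Subgraph.deleteVerts_verts] at this
      exact this.2 (mem_coe.2 (mem_biUnion.2 ⟨t, htC, hat⟩))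
    · calc (C.biUnion D.bag).card ≤ C.card * (w + 1) :=
            card_biUnion_le_card_mul _ _ _ fun t _ => D.card_bag_le hD t
        _ ≤ ((h ^ 2 - h + 1) * (k - 1)) * (w + 1) := Nat.mul_le_mul_right _ hC
        _ = _ := by ring

end TreeDecomposition

theorem exists_treeDecomposition_width_eq_treeWidth {V : Type*} [Finite V] (G : SimpleGraph V) :
    ∃ (m : ℕ) (T : SimpleGraph (Fin m)) (D : TreeDecomposition G T), D.width = treeWidth G := by
  have := Fintype.ofFinite V
  refine Int.csInf_mem (s := {n : ℤ | ∃ (m : ℕ) (T : SimpleGraph (Fin m))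
    (D : TreeDecomposition G T), D.width = n}) ?_ ?_
  · let D : TreeDecomposition G (⊥ : SimpleGraph (Fin 1)) :=
      { isTree := SimpleGraph.IsTree.of_subsingleton
        bag := fun _ => univ
        cover := fun a => ⟨0, mem_univ a⟩
        edge_mem := fun a b _ => ⟨0, mem_univ a, mem_univ b⟩
        path_mem := fun _ _ _ _ _ _ a _ _ => mem_univ a }
    exact ⟨D.width, 1, _, D, rfl⟩
  · refine ⟨-1, ?_⟩
    rintro n ⟨m, T, D, rfl⟩
    rw [TreeDecomposition.width]
    omega

theorem ModelFunction.exists_finset_connected {V W : Type*} [Finite W] [Nonempty W]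
    {H : SimpleGraph W} {G : SimpleGraph V} (η : ModelFunction H G) :
    ∃ B : Finset G.Subgraph, B.Nonempty ∧ B.card ≤ Nat.card W ∧
      (∀ X ∈ B, X.Connected) ∧ η.image.verts = ⋃ X ∈ B, X.verts := by
  classical
  have := Fintype.ofFinite W
  refine ⟨univ.image η.branch, univ_nonempty.image _, ?_, ?_, ?_⟩
  · rw [Nat.card_eq_fintype_card]
    exact card_image_le
  · intro X hX
    obtain ⟨a, -, rfl⟩ := mem_image.1 hX
    exact η.branch_connected a
  · simp [ModelFunction.image]

end RootedMinor

theorem mainTheorem6 {V W ι : Type*} [Fintype V] [Fintype W] [Finite ι]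
    (G : SimpleGraph V) (H : SimpleGraph W) (Z : ι → Set V) (k h ℓ w : ℕ)
    (hk : 0 < k) (hh : 0 < h) (hℓ : 0 < ℓ) (hw : 0 < w)
    (hH : Fintype.card W = h) (hG : RootedMinor.treeWidth G ≤ (w : ℤ)) :
    (RootedMinor.HasDisjoint (G := G) (RootedMinor.IsRootedModel H Z ℓ) k ∨
      ∃ S : Finset V, RootedMinor.IsDeletionSet (G := G) (RootedMinor.IsRootedModel H Z ℓ) S ∧
        S.card ≤ (w + 1) * (h ^ 2 - h + 1) * (k - 1)) ∧
    (RootedMinor.HasDisjoint (G := G) (RootedMinor.IsPureRootedModel H Z ℓ) k ∨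
      ∃ S : Finset V, RootedMinor.IsDeletionSet (G := G) (RootedMinor.IsPureRootedModel H Z ℓ) S ∧
        S.card ≤ (w + 1) * (h ^ 2 - h + 1) * (k - 1)) := by
  obtain ⟨m, T, D, hD⟩ := RootedMinor.exists_treeDecomposition_width_eq_treeWidth G
  have hDw : D.width ≤ w := hD.trans_le hG
  refine ⟨D.hasDisjoint_or_exists_isDeletionSet hDw hh hk _ ?_,
    D.hasDisjoint_or_exists_isDeletionSet hDw hh hk _ ?_⟩
  · rintro F ⟨⟨η, rfl⟩, -⟩
    have : Nonempty W := Fintype.card_pos_iff.1 (hH ▸ hh)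
    obtain ⟨B, h1, h2, h3, h4⟩ := η.exists_finset_connected
    exact ⟨B, h1, h2.trans_eq (by rw [Nat.card_eq_fintype_card, hH]), h3, h4⟩
  · rintro F ⟨C, α, η, rfl, hne, hα, -, hcard⟩
    -- Since `ℓ` is positive, some `α c` contributes a member, so a pure model has at least one
    -- branch set.
    obtain ⟨i, ⟨c, hi⟩, -⟩ := Set.nonempty_of_ncard_ne_zero (hcard.trans_ne hℓ.ne')
    obtain ⟨a, -⟩ := hα c i hi
    have : Nonempty {a : W // H.connectedComponentMk a ∈ C} := ⟨a⟩
    obtain ⟨B, h1, h2, h3, h4⟩ := η.exists_finset_connected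
    refine ⟨B, h1, h2.trans ?_, h3, h4⟩
    rw [← hH, ← Nat.card_eq_fintype_card]
    exact Nat.card_le_card_of_injective _ Subtype.val_injective
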